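/- Let $\alpha_0,\beta_0,\gamma_0>0$ and $\lambda_1^0\in\mathbb{R}$. There is a constant $C>0$, depending only on $\alpha_0,\beta_0,\gamma_0$ and $\lambda_1^0$, with the following property. Let $\Omega\subset\mathbb{R}^3$ be a bounded Lipschitz domain and let $\lambda,\mu,\rho$ be measurable real functions on $\Omega$ such that, almost everywhere in $\Omega$, $$\alpha_0\le\mu\le\alpha_0^{-1},\qquad \beta_0\le 2\mu+3\lambda\le\beta_0^{-1},\qquad 0\le\rho\le\gamma_0^{-1}.$$ Let $\mathbb{C}=\lambda I_3\otimes I_3+2\mu\,\mathbb{I}_{sym}$, that is, $\mathbb{C}A=\lambda\,\mathrm{tr}(A)I_3+2\mu\hat A$ with $\hat A=\frac12(A+A^T)$, and write $\hat\nabla u=\frac12(\nabla u+(\nabla u)^T)$ and $A:B=\sum_{i,j}A_{ij}B_{ij}$. Suppose that $\lambda_1^0$ is the smallest Dirichlet eigenvalue in $\Omega$ of the operator $-\operatorname{div}(\mathbb{C}_0\hat\nabla u)$, where $\mathbb{C}_0=\frac{\beta_0-3\alpha_0}{2}I_3\otimes I_3+2\alpha_0\mathbb{I}_{sym}$; here $\kappa$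 is a Dirichlet eigenvalue if there is a nonzero $u\in H^1_0(\Omega;\mathbb{R}^3)$ with $\int_\Omega\mathbb{C}_0\hat\nabla u:\hat\nabla v\,dx=\kappa\int_\Omega u\cdot v\,dx$ for all $v\in H^1_0(\Omega;\mathbb{R}^3)$. Let $\omega\in\mathbb{R}$ with $\omega^2\in\left(0,\frac{\gamma_0\lambda_1^0}{2}\right]$. Then for every $f\in H^{-1}(\Omega;\mathbb{R}^3)=(H^1_0(\Omega;\mathbb{R}^3))^*$ and every $g\in H^{1/2}(\partial\Omega;\mathbb{R}^3)$ the Dirichlet problem $$\operatorname{div}(\mathbb{C}\hat\nabla u)+\rho\,\omega^2u=f\ \text{ in }\Omega,\qquad u=g\ \text{ on }\partial\Omega,$$ has exactly one weak solution $u\in H^1(\Omega;\mathbb{R}^3)$, that is, exactly one $u\in H^1(\Omega;\mathbb{R}^3)$ with trace $g$ such that $-\int_\Omega\mathbb{C}\hat\nabla u:\hat\nabla v\,dx+\omega^2\int_\Omega\rho\,u\cdot v\,dx=\langle f,v\rangle$ for all $v\in H^1_0(\Omega;\mathbb{R}^3)$; and this solution satisfies $$\|u\|_{H^1(\Omega)}\le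 C\left(\|g\|_{H^{1/2}(\partial\Omega)}+\|f\|_{H^{-1}(\Omega)}\right).$$ Here $H^1_0(\Omega;\mathbb{R}^3)$ is the closure of $C_c^\infty(\Omega;\mathbb{R}^3)$ in $H^1(\Omega;\mathbb{R}^3)$, with $\|u\|_{H^1}^2=\|u\|_{L^2}^2+\|\nabla u\|_{L^2}^2$; the norm of $H^{-1}$ is the dual norm; and $H^{1/2}(\partial\Omega;\mathbb{R}^3)$ is the trace space $H^1(\Omega;\mathbb{R}^3)/H^1_0(\Omega;\mathbb{R}^3)$ of $H^1(\Omega;\mathbb{R}^3)$ with the trace norm $\|g\|_{H^{1/2}(\partial\Omega)}=\inf\{\|w\|_{H^1(\Omega)}: w\in H^1(\Omega;\mathbb{R}^3),\ w=g\text{ on }\partial\Omega\}$. -/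

import Mathlib

open MeasureTheory Set Metric

noncomputable section

namespace Elasticity

/-- The Euclidean space `ℝ³`, in which displacement fields also take their values. -/
abbrev E3 : Type := EuclideanSpace ℝ (Fin 3)

/-- The `3 × 3` matrices as a Euclidean space, so that the norm is `|A|² = A : A`. It is the
value space of gradients; the entry with index `(i, j)` is the entry in row `i`, column `j`. -/
abbrev M33 : Type := EuclideanSpace ℝ (Fin 3 × Fin 3)

/-! ### Lipschitz domains -/

/-- `Ω` is of Lipschitz class with constants `r₀`, `L`: around each boundary point `P` there are
rigid coordinates `e`, with `P` at the origin, in which `Ω` is, inside the cylinder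
`{|x'| < r₀, |x₃| < L r₀}`, the part above the graph of an `L`-Lipschitz function `ψ` on the disc
`{|x'| < r₀}` with `ψ 0 = 0`. -/
def IsLipschitzClass (Ω : Set E3) (r₀ : ℝ) (L : NNReal) : Prop :=
  ∀ P ∈ frontier Ω, ∃ (e : E3 ≃ᵃⁱ[ℝ] E3) (ψ : EuclideanSpace ℝ (Fin 2) → ℝ),
    e P = 0 ∧ ψ 0 = 0 ∧ LipschitzOnWith L ψ (ball 0 r₀) ∧
    ∀ y : E3, !₂[y 0, y 1] ∈ ball (0 : EuclideanSpace ℝ (Fin 2)) r₀ → |y 2| < L * r₀ →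
      (e.symm y ∈ Ω ↔ ψ !₂[y 0, y 1] < y 2)

/-- Bounded Lipschitz domains of `ℝ³`. -/
structure IsBoundedLipschitzDomain (Ω : Set E3) : Prop where
  isOpen : IsOpen Ω
  isConnected : IsConnected Ω
  isBounded : Bornology.IsBounded Ω
  lipschitz : ∃ (r₀ : ℝ) (L : NNReal), 0 < r₀ ∧ 1 ≤ L ∧ IsLipschitzClass Ω r₀ L

/-! ### Sobolev spaces -/

section

open scoped ContDiff

/-- `φ ∈ C_c^∞(Ω; F)`. -/
structure IsTestFunction {F : Type*} [NormedAddCommGroup F] [NormedSpace ℝ F]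
    (Ω : Set E3) (φ : E3 → F) : Prop where
  contDiff : ContDiff ℝ ∞ φ
  hasCompactSupport : HasCompactSupport φ
  tsupport_subset : tsupport φ ⊆ Ω

end

/-- The partial derivative `∂_j φ` of a scalar function. -/
def pderiv (j : Fin 3) (φ : E3 → ℝ) (x : E3) : ℝ :=
  fderiv ℝ φ x (EuclideanSpace.single j 1)

/-- The space `L²(Ω; F)`. -/
abbrev L2 (Ω : Set E3) (F : Type*) [NormedAddCommGroup F] : Type _ :=
  Lp F 2 (volume.restrict Ω)

/-- `G` is the weak (distributional) gradient of the vector field `u` in `Ω`: the entry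
`G_{ij}` is the weak derivative `∂_j u_i`. -/
def IsWeakGradient (Ω : Set E3) (u : L2 Ω E3) (G : L2 Ω M33) : Prop :=
  ∀ φ : E3 → ℝ, IsTestFunction Ω φ → ∀ i j : Fin 3,
    ∫ x in Ω, u x i * pderiv j φ x = - ∫ x in Ω, G x (i, j) * φ x

theorem IsTestFunction.memLp {Ω : Set E3} {φ : E3 → ℝ} (h : IsTestFunction Ω φ) :
    MemLp φ 2 (volume.restrict Ω) :=
  (h.contDiff.continuous.memLp_of_hasCompactSupport h.hasCompactSupport).restrict Ω

theorem IsTestFunction.memLp_pderiv {Ω : Set E3} {φ : E3 → ℝ} (h : IsTestFunction Ω φ)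
    (j : Fin 3) : MemLp (pderiv j φ) 2 (volume.restrict Ω) := by
  have hc : Continuous (pderiv j φ) :=
    (h.contDiff.continuous_fderiv (by simp)).clm_apply continuous_const
  have hs : HasCompactSupport (pderiv j φ) :=
    h.hasCompactSupport.fderiv_apply (𝕜 := ℝ) (EuclideanSpace.single j 1)
  exact (hc.memLp_of_hasCompactSupport hs).restrict Ω

theorem integrable_coord_mul {Ω : Set E3} {ι : Type*} [Fintype ι]
    (w : L2 Ω (EuclideanSpace ℝ ι)) (k : ι) {ψ : E3 → ℝ}
    (hψ : MemLp ψ 2 (volume.restrict Ω)) :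
    Integrable (fun x => w x k * ψ x) (volume.restrict Ω) := by
  have h1 : MemLp (fun x => w x k) 2 (volume.restrict Ω) :=
    (Lp.memLp w).continuousLinearMap_comp (EuclideanSpace.proj (𝕜 := ℝ) k)
  exact h1.integrable_mul hψ

/-- The Sobolev space `H¹(Ω; ℝ³)`. An element is a field in `L²` together with its weak gradient
in `L²` (which the field determines); the norm inherited from the Hilbert sum is
`‖u‖² = ‖u‖²_{L²} + ‖∇u‖²_{L²}`. -/
def H1 (Ω : Set E3) : Submodule ℝ (WithLp 2 (L2 Ω E3 × L2 Ω M33)) where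
  carrier := {p | IsWeakGradient Ω p.fst p.snd}
  zero_mem' := by
    intro φ hφ i j
    have h1 : ∫ x in Ω, (0 : L2 Ω E3) x i * pderiv j φ x = ∫ x in Ω, (0 : ℝ) := by
      refine integral_congr_ae ?_
      filter_upwards [Lp.coeFn_zero E3 2 (volume.restrict Ω)] with x hx
      rw [hx]
      simp
    have h2 : ∫ x in Ω, (0 : L2 Ω M33) x (i, j) * φ x = ∫ x in Ω, (0 : ℝ) := by
      refine integral_congr_ae ?_
      filter_upwards [Lp.coeFn_zero M33 2 (volume.restrict Ω)] with x hx
      rw [hx]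
      simp
    simp only [WithLp.zero_fst, WithLp.zero_snd]
    rw [h1, h2]
    simp
  add_mem' := by
    intro p q hp hq φ hφ i j
    have h1 : ∫ x in Ω, (p.fst + q.fst) x i * pderiv j φ x
        = ∫ x in Ω, (p.fst x i * pderiv j φ x + q.fst x i * pderiv j φ x) := by
      refine integral_congr_ae ?_
      filter_upwards [Lp.coeFn_add p.fst q.fst] with x hx
      rw [hx]
      simp [add_mul]
    have h2 : ∫ x in Ω, (p.snd + q.snd) x (i, j) * φ x
        = ∫ x in Ω, (p.snd x (i, j) * φ x + q.snd x (i, j) * φ x) := by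
      refine integral_congr_ae ?_
      filter_upwards [Lp.coeFn_add p.snd q.snd] with x hx
      rw [hx]
      simp [add_mul]
    simp only [WithLp.add_fst, WithLp.add_snd]
    rw [h1, h2, integral_add (integrable_coord_mul _ _ (hφ.memLp_pderiv j))
      (integrable_coord_mul _ _ (hφ.memLp_pderiv j)),
      integral_add (integrable_coord_mul _ _ hφ.memLp) (integrable_coord_mul _ _ hφ.memLp),
      hp φ hφ i j, hq φ hφ i j]
    ring
  smul_mem' := by
    intro c p hp φ hφ i j
    have h1 : ∫ x in Ω, (c • p.fst) x i * pderiv j φ x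
        = ∫ x in Ω, c * (p.fst x i * pderiv j φ x) := by
      refine integral_congr_ae ?_
      filter_upwards [Lp.coeFn_smul c p.fst] with x hx
      rw [hx]
      simp [mul_assoc]
    have h2 : ∫ x in Ω, (c • p.snd) x (i, j) * φ x
        = ∫ x in Ω, c * (p.snd x (i, j) * φ x) := by
      refine integral_congr_ae ?_
      filter_upwards [Lp.coeFn_smul c p.snd] with x hx
      rw [hx]
      simp [mul_assoc]
    simp only [WithLp.smul_fst, WithLp.smul_snd]
    rw [h1, h2, integral_const_mul, integral_const_mul, hp φ hφ i j]
    ring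

/-- The underlying vector field of an element of `H¹(Ω; ℝ³)`. -/
def fld {Ω : Set E3} (u : H1 Ω) (x : E3) : E3 := u.1.fst x

/-- The weak gradient `∇u`, as a matrix field: `(∇u)_{ij} = ∂_j u_i`. -/
def grad {Ω : Set E3} (u : H1 Ω) (x : E3) : Matrix (Fin 3) (Fin 3) ℝ :=
  Matrix.of fun i j => u.1.snd x (i, j)

/-- The elements of `H¹(Ω; ℝ³)` that are represented by a field in `C_c^∞(Ω; ℝ³)`. -/
def smoothCompact (Ω : Set E3) : Submodule ℝ (H1 Ω) where
  carrier := {u | ∃ φ : E3 → E3, IsTestFunction Ω φ ∧ fld u =ᵐ[volume.restrict Ω] φ}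
  zero_mem' := by
    refine ⟨0, ⟨contDiff_const, HasCompactSupport.zero, ?_⟩, ?_⟩
    · simp [tsupport]
    · exact Lp.coeFn_zero E3 2 (volume.restrict Ω)
  add_mem' := by
    rintro u v ⟨φ, hφ, hu⟩ ⟨ψ, hψ, hv⟩
    refine ⟨φ + ψ, ⟨hφ.contDiff.add hψ.contDiff, hφ.hasCompactSupport.add hψ.hasCompactSupport,
      (tsupport_add φ ψ).trans (union_subset hφ.tsupport_subset hψ.tsupport_subset)⟩, ?_⟩
    filter_upwards [Lp.coeFn_add u.1.fst v.1.fst, hu, hv] with x hx hux hvx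
    simp only [fld] at hux hvx ⊢
    simpa [hux, hvx] using hx
  smul_mem' := by
    rintro c u ⟨φ, hφ, hu⟩
    refine ⟨c • φ, ⟨hφ.contDiff.const_smul c, hφ.hasCompactSupport.smul_left (f := fun _ => c),
      (closure_mono (Function.support_const_smul_subset c φ)).trans hφ.tsupport_subset⟩, ?_⟩
    filter_upwards [Lp.coeFn_smul c u.1.fst, hu] with x hx hux
    simp only [fld] at hux ⊢
    simpa [hux] using hx

/-- `H¹₀(Ω; ℝ³)`, the closure of `C_c^∞(Ω; ℝ³)` in `H¹(Ω; ℝ³)`. -/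
def H10 (Ω : Set E3) : Submodule ℝ (H1 Ω) := (smoothCompact Ω).topologicalClosure

/-- `H⁻¹(Ω; ℝ³)`, the dual of `H¹₀(Ω; ℝ³)`, with the dual norm. -/
abbrev Hneg1 (Ω : Set E3) : Type := StrongDual ℝ (H10 Ω)

/-- `H^{1/2}(∂Ω; ℝ³)`, the space of boundary values (traces) of the fields in `H¹(Ω; ℝ³)`. Two
fields have the same trace when their difference is in `H¹₀`, so the trace space of a Lipschitz
domain is `H¹ / H¹₀`; its norm is the trace norm
`‖g‖ = inf {‖w‖_{H¹} : w ∈ H¹, w = g on ∂Ω}`. -/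
abbrev Hhalf (Ω : Set E3) : Type := H1 Ω ⧸ H10 Ω

/-- The trace operator `u ↦ u|_{∂Ω}` from `H¹(Ω; ℝ³)` to `H^{1/2}(∂Ω; ℝ³)`. -/
def trace {Ω : Set E3} (u : H1 Ω) : Hhalf Ω := (H10 Ω).mkQ u

/-! ### The elasticity system -/

/-- `Â = (A + Aᵀ) / 2`. -/
def symPart (A : Matrix (Fin 3) (Fin 3) ℝ) : Matrix (Fin 3) (Fin 3) ℝ :=
  (1 / 2 : ℝ) • (A + A.transpose)

/-- `A : B = ∑ A_{ij} B_{ij}`. -/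
def ddot (A B : Matrix (Fin 3) (Fin 3) ℝ) : ℝ := ∑ i, ∑ j, A i j * B i j

/-- The action `A ↦ ℂ A` of the isotropic tensor `ℂ = lam I₃ ⊗ I₃ + 2 mu 𝕀_sym`. -/
def isoTensor (lam mu : ℝ) (A : Matrix (Fin 3) (Fin 3) ℝ) : Matrix (Fin 3) (Fin 3) ℝ :=
  (lam * ddot 1 A) • (1 : Matrix (Fin 3) (Fin 3) ℝ) + (2 * mu) • symPart A

/-- The strain tensor `∇̂u = (∇u + (∇u)ᵀ) / 2`. -/
def strain {Ω : Set E3} (u : H1 Ω) (x : E3) : Matrix (Fin 3) (Fin 3) ℝ := symPart (grad u x)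

/-- `∫_Ω ℂ ∇̂u : ∇̂v dx` for the isotropic tensor field with Lamé parameters `lam`, `mu`. -/
def elasticForm {Ω : Set E3} (lam mu : E3 → ℝ) (u v : H1 Ω) : ℝ :=
  ∫ x in Ω, ddot (isoTensor (lam x) (mu x) (strain u x)) (strain v x)

/-- `∫_Ω ρ u · v dx`. -/
def massForm {Ω : Set E3} (ρ : E3 → ℝ) (u v : H1 Ω) : ℝ :=
  ∫ x in Ω, ρ x * inner ℝ (fld u x) (fld v x)

/-- `κ` is a Dirichlet eigenvalue in `Ω` of `-div(ℂ ∇̂u)`, for Lamé parameters `lam`, `mu`. -/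
def IsDirichletEigenvalue (Ω : Set E3) (lam mu : E3 → ℝ) (κ : ℝ) : Prop :=
  ∃ u ∈ H10 Ω, u ≠ 0 ∧
    ∀ v ∈ H10 Ω, elasticForm lam mu u v = κ * massForm (fun _ => 1) u v

/-- `κ` is the smallest Dirichlet eigenvalue in `Ω` of `-div(ℂ₀ ∇̂u)`, where
`ℂ₀ = (β₀ - 3 α₀) / 2 I₃ ⊗ I₃ + 2 α₀ 𝕀_sym`. -/
def IsSmallestDirichletEigenvalue (Ω : Set E3) (α₀ β₀ κ : ℝ) : Prop :=
  IsLeast {k | IsDirichletEigenvalue Ω (fun _ => (β₀ - 3 * α₀) / 2) (fun _ => α₀) k} κ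

/-- The Lamé parameters and the density are measurable and satisfy, a.e. in `Ω`,
`α₀ ≤ mu ≤ α₀⁻¹`, `β₀ ≤ 2 mu + 3 lam ≤ β₀⁻¹` and `0 ≤ ρ ≤ γ₀⁻¹`. -/
structure AdmissibleCoefficients (Ω : Set E3) (α₀ β₀ γ₀ : ℝ) (lam mu ρ : E3 → ℝ) : Prop where
  aemeasurable_lam : AEMeasurable lam (volume.restrict Ω)
  aemeasurable_mu : AEMeasurable mu (volume.restrict Ω)
  aemeasurable_rho : AEMeasurable ρ (volume.restrict Ω)
  mu_bounds : ∀ᵐ x ∂(volume.restrict Ω), α₀ ≤ mu x ∧ mu x ≤ α₀⁻¹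
  lam_bounds : ∀ᵐ x ∂(volume.restrict Ω),
    β₀ ≤ 2 * mu x + 3 * lam x ∧ 2 * mu x + 3 * lam x ≤ β₀⁻¹
  rho_bounds : ∀ᵐ x ∂(volume.restrict Ω), 0 ≤ ρ x ∧ ρ x ≤ γ₀⁻¹

/-- `u ∈ H¹(Ω; ℝ³)` is a weak solution of `div(ℂ ∇̂u) + ρ ω² u = f` in `Ω`, `u = g` on `∂Ω`. -/
structure IsWeakSolution {Ω : Set E3} (lam mu ρ : E3 → ℝ) (ω : ℝ) (f : Hneg1 Ω) (g : Hhalf Ω)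
    (u : H1 Ω) : Prop where
  weak_eq : ∀ v : H10 Ω,
    - elasticForm lam mu u (v : H1 Ω) + ω ^ 2 * massForm ρ u (v : H1 Ω) = f v
  boundary : trace u = g

end Elasticity

end

noncomputable section

namespace Elasticity

/-! ### Hilbert space part: Rayleigh quotients and Lax-Milgram with boundary data -/

section Abstract

open Filter Topology

variable {H : Type*} [NormedAddCommGroup H] [InnerProductSpace ℝ H]

/-! Everything rests on one coercivity estimate in H¹₀ whose constant sees Ω only through λ₁⁰. Given
it, subtracting a lift of g and applying Lax-Milgram solves the problem, and taking the infimum over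
lifts gives the bound in the trace norm (`existsUnique_of_coercive_of_boundary`).

Coercivity (`elastic_sub_mass_coercive`). In H¹₀ two integrations by parts give ∫ ∂_j u_i ∂_i u_j =
∫ ∂_i u_i ∂_j u_j. Hence ‖div u‖ ≤ ‖∇u‖, and for constant parameters the elastic energy is μ‖∇u‖² +
(λ+μ)‖div u‖²; this plays the role of Korn's inequality. The tensor ℂ₀ need not lie below ℂ
pointwise, but ½ℂ₀ + α₀𝕀_sym does. As ω²ρ ≤ λ₁⁰/2, the mass term is absorbed by the half of ℂ₀
through the Rayleigh bound λ₁⁰‖u‖² ≤ ∫ ℂ₀∇̂u : ∇̂u, and α₀𝕀_sym leaves (α₀/2)(‖∇u‖² + ‖div u‖²).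

The Rayleigh bound. Since λ₁⁰ is given only as the least eigenvalue, the minimal quotient has to be
shown to be an eigenvalue, that is, to be attained (`rayleigh_lower_bound`). The compactness needed
is Rellich's theorem in a finite form: on a grid of cubes of side h, ‖φ‖² is at most a sum of
squared cube integrals, suitably weighted, plus 12h²‖Dφ‖² (`integral_norm_sq_le_sum_cube`). So up to
ε‖u‖² finitely many functionals control the L² norm (`exists_finite_functionals`). -/

theorem bilin_eq_zero_of_nonneg {D : H →L[ℝ] H →L[ℝ] ℝ} (hsymm : ∀ u v, D u v = D v u)
    (hpos : ∀ u, 0 ≤ D u u) {x : H} (hx : D x x = 0) (v : H) : D x v = 0 := by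
  have key : ∀ t : ℝ, 0 ≤ 2 * t * D x v + t ^ 2 * D v v := by
    intro t
    have h := hpos (x + t • v)
    simp only [map_add, map_smul, add_apply, smul_apply,
      smul_eq_mul, hx, hsymm v x] at h
    linarith
  by_contra hne
  have hv := hpos v
  -- Near-optimal `t` for the quadratic polynomial; the `+ 1` keeps the denominator positive when `D
  -- v v = 0`.
  have h1 := key (-(D x v) / (D v v + 1))
  have h2 : 2 * (-(D x v) / (D v v + 1)) * D x v + (-(D x v) / (D v v + 1)) ^ 2 * D v v
      = -((D x v) ^ 2 * (D v v + 2) / (D v v + 1) ^ 2) := by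
    field_simp
    ring
  rw [h2] at h1
  have : 0 < (D x v) ^ 2 * (D v v + 2) / (D v v + 1) ^ 2 := by positivity
  linarith

/-- A form `N ≥ 0` that is relatively compact with respect to `A + N` (it is, up to
`ε ‖u‖²`, bounded by finitely many functionals) attains its minimal Rayleigh quotient, so that a
lower bound for the eigenvalues of `A` relative to `N` is a lower bound for the quotient. -/
theorem rayleigh_lower_bound [CompleteSpace H] {A N : H →L[ℝ] H →L[ℝ] ℝ} (hA : ∀ u v, A u v = A v u)
    (hN : ∀ u v, N u v = N v u) (hNpos : ∀ u, 0 ≤ N u u) {c : ℝ} (hc : 0 < c)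
    (hcoer : ∀ u, c * ‖u‖ ^ 2 ≤ A u u + N u u)
    (hcpt : ∀ ε : ℝ, 0 < ε → ∃ (ι : Type) (_ : Fintype ι) (F : ι → (H →L[ℝ] ℝ)),
      ∀ u, N u u ≤ ∑ k, (F k u) ^ 2 + ε * ‖u‖ ^ 2)
    {κ : ℝ} (hκ : ∀ k : ℝ, (∃ u : H, u ≠ 0 ∧ ∀ v, A u v = k * N u v) → κ ≤ k) (u : H) :
    κ * N u u ≤ A u u := by
  -- `B` is coercive while `A` alone need not be, so `N / B` is maximised instead of minimising `A /
  -- N`; the maximum `m` corresponds to the eigenvalue `1 / m - 1`.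
  set B : H →L[ℝ] H →L[ℝ] ℝ := A + N with hB
  have hBa : ∀ u v, B u v = A u v + N u v := fun u v => rfl
  have hBpos : ∀ u, 0 ≤ B u u := fun u => le_trans (by positivity) (hcoer u)
  have hnorm : ∀ u, B u u ≤ 1 → ‖u‖ ^ 2 ≤ 1 / c := by
    intro u hu
    rw [le_div_iff₀ hc]
    have := hcoer u
    rw [← hBa] at this
    linarith
  set S : Set ℝ := (fun u => N u u) '' {u | B u u ≤ 1} with hS
  have hSne : S.Nonempty := ⟨_, 0, by simp, rfl⟩
  have hSb : BddAbove S := by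
    refine ⟨‖N‖ * (1 / c), ?_⟩
    rintro _ ⟨u, hu, rfl⟩
    calc N u u ≤ ‖N u u‖ := le_abs_self _
      _ ≤ ‖N‖ * ‖u‖ * ‖u‖ := N.le_opNorm₂ u u
      _ = ‖N‖ * ‖u‖ ^ 2 := by ring
      _ ≤ ‖N‖ * (1 / c) := by gcongr; exact hnorm u hu
  set m : ℝ := sSup S with hm
  have hle : ∀ u, N u u ≤ m * B u u := by
    intro u
    rcases (hBpos u).eq_or_lt with h0 | hp
    · have : ‖u‖ ^ 2 ≤ 0 := by
        have := hcoer u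
        rw [← hBa, ← h0] at this
        nlinarith
      have hu : u = 0 := by
        have : ‖u‖ = 0 := by nlinarith [norm_nonneg u]
        simpa using this
      simp [hu]
    · set s := (Real.sqrt (B u u))⁻¹ with hs
      have hs2 : s * s = (B u u)⁻¹ := by
        rw [hs, ← mul_inv, Real.mul_self_sqrt hp.le]
      have h1 : N (s • u) (s • u) ≤ m := by
        refine le_csSup hSb ⟨s • u, ?_, rfl⟩
        simp only [mem_ofPred_eq, map_smul, smul_apply, smul_eq_mul]
        rw [← mul_assoc, hs2, inv_mul_cancel₀ hp.ne']
      simp only [map_smul, smul_apply, smul_eq_mul] at h1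
      rw [← mul_assoc, hs2, inv_mul_le_iff₀ hp] at h1
      linarith
  have hm0 : 0 ≤ m := le_csSup hSb ⟨0, by simp, by simp⟩
  rcases hm0.eq_or_lt with hm0 | hm0
  -- If `m = 0` then `N` vanishes on the diagonal and `A u u = B u u ≥ 0`.
  · have h1 := hle u
    rw [← hm0, zero_mul] at h1
    have h2 : N u u = 0 := le_antisymm h1 (hNpos u)
    have h3 := hBpos u
    rw [hBa, h2] at h3
    rw [h2]
    linarith
  -- `D ≥ 0` tends to `0` along a maximising sequence; a zero of its quadratic form lies in its
  -- kernel, which is the eigenvalue equation.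
  set D : H →L[ℝ] H →L[ℝ] ℝ := m • B - N with hD
  have hDa : ∀ u v, D u v = m * B u v - N u v := fun u v => rfl
  have hDpos : ∀ u, 0 ≤ D u u := fun u => by rw [hDa]; linarith [hle u]
  have hDs : ∀ u v, D u v = D v u := fun u v => by
    rw [hDa, hDa, hBa, hBa, hA u v, hN u v]
  obtain ⟨y, -, hy, hyS⟩ := exists_seq_tendsto_sSup hSne hSb
  choose x hx1 hx2 using hyS
  simp only [mem_ofPred_eq] at hx1
  -- Along an ultrafilter every bounded real sequence converges, so no subsequences have to be
  -- extracted for the functionals `F`.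
  have hU : Tendsto y (hyperfilter ℕ : Filter ℕ) (𝓝 m) :=
    hy.mono_left Nat.hyperfilter_le_atTop
  have hNx : Tendsto (fun n => N (x n) (x n)) (hyperfilter ℕ : Filter ℕ) (𝓝 m) := by
    simpa only [hx2] using hU
  have hDx : Tendsto (fun n => D (x n) (x n)) (hyperfilter ℕ : Filter ℕ) (𝓝 0) := by
    have h1 : Tendsto (fun n => m - N (x n) (x n)) (hyperfilter ℕ : Filter ℕ) (𝓝 0) := by
      simpa using hNx.const_sub m
    refine squeeze_zero (fun n => hDpos _) (fun n => ?_) h1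
    rw [hDa]
    have := mul_le_mul_of_nonneg_left (hx1 n) hm0.le
    linarith
  have hxb : ∀ n, ‖x n‖ ≤ Real.sqrt (1 / c) := fun n => Real.le_sqrt_of_sq_le (hnorm _ (hx1 n))
  have hF : ∀ F : H →L[ℝ] ℝ, ∃ a, Tendsto (fun n => F (x n)) (hyperfilter ℕ : Filter ℕ) (𝓝 a) := by
    intro F
    have hK : IsCompact (closedBall (0 : ℝ) (‖F‖ * Real.sqrt (1 / c))) :=
      isCompact_closedBall _ _
    obtain ⟨a, -, ha⟩ := hK.ultrafilter_le_nhds ((hyperfilter ℕ).map fun n => F (x n)) (by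
      rw [le_principal_iff, Ultrafilter.mem_coe, Ultrafilter.mem_map]
      refine Filter.univ_mem' fun n => mem_closedBall_zero_iff.2 ?_
      exact (F.le_opNorm _).trans (mul_le_mul_of_nonneg_left (hxb n) (norm_nonneg _)))
    exact ⟨a, ha⟩
  have hcau : Cauchy (Filter.map x (hyperfilter ℕ : Filter ℕ)) := by
    rw [Metric.cauchy_iff]
    refine ⟨inferInstance, fun ε hε => ?_⟩
    -- For a difference `w` of two late terms, `m c ‖w‖² ≤ m B w w = D w w + N w w`. The constants
    -- make `D w w`, the sum of squares and the remainder (with `‖w‖² ≤ 4 / c`) each at most `c m ε²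
    -- / 4`, three quarters of the target in total.
    obtain ⟨ι, _, F, hFN⟩ := hcpt (c * m * c * ε ^ 2 / 16) (by positivity)
    choose a ha using fun k => hF (F k)
    set δ : ℝ := c * m * ε ^ 2 / (16 * (Fintype.card ι + 1)) with hδ
    have hδ0 : 0 < δ := by positivity
    have e1 : ∀ᶠ i in (hyperfilter ℕ : Filter ℕ), ∀ k, dist (F k (x i)) (a k) < Real.sqrt δ := by
      rw [Filter.eventually_all]
      intro k
      exact Metric.tendsto_nhds.1 (ha k) _ (Real.sqrt_pos.2 hδ0)
    have e2 : ∀ᶠ i in (hyperfilter ℕ : Filter ℕ), D (x i) (x i) < c * m * ε ^ 2 / 16 :=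
      hDx.eventually_lt_const (by positivity)
    refine ⟨x '' {i | (∀ k, dist (F k (x i)) (a k) < Real.sqrt δ) ∧
      D (x i) (x i) < c * m * ε ^ 2 / 16}, image_mem_map (e1.and e2), ?_⟩
    rintro _ ⟨i, ⟨hi1, hi2⟩, rfl⟩ _ ⟨j, ⟨hj1, hj2⟩, rfl⟩
    rw [dist_eq_norm]
    set w := x i - x j with hw
    -- Parallelogram identity for `D`, dropping the nonnegative value at `x i + x j`.
    have hDw : D w w ≤ 2 * (D (x i) (x i) + D (x j) (x j)) := by
      have := hDpos (x i + x j)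
      simp only [hw, map_add, map_sub, add_apply,
        sub_apply] at this ⊢
      linarith
    have hFw : ∀ k, (F k w) ^ 2 ≤ 4 * δ := by
      intro k
      have h1 := hi1 k
      have h2 := hj1 k
      have h3 : |F k w| ≤ 2 * Real.sqrt δ := by
        rw [hw, map_sub, ← Real.dist_eq]
        calc _ ≤ dist (F k (x i)) (a k) + dist (F k (x j)) (a k) := dist_triangle_right _ _ _
          _ ≤ _ := by linarith
      calc (F k w) ^ 2 = |F k w| ^ 2 := (sq_abs _).symm
        _ ≤ (2 * Real.sqrt δ) ^ 2 := by gcongr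
        _ = 4 * δ := by rw [mul_pow, Real.sq_sqrt hδ0.le]; ring
    have hsum : ∑ k, (F k w) ^ 2 ≤ c * m * ε ^ 2 / 4 := by
      calc ∑ k, (F k w) ^ 2 ≤ ∑ _k : ι, 4 * δ := Finset.sum_le_sum fun k _ => hFw k
        _ = Fintype.card ι * (4 * δ) := by simp
        _ ≤ (Fintype.card ι + 1) * (4 * δ) := by gcongr; linarith
        _ = c * m * ε ^ 2 / 4 := by rw [hδ]; field_simp; ring
    have hwn : ‖w‖ ^ 2 ≤ 4 / c := by
      have h1 := parallelogram_law_with_norm ℝ (x i) (x j)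
      have h2 := hnorm _ (hx1 i)
      have h3 := hnorm _ (hx1 j)
      have h4 : (4 : ℝ) / c = 4 * (1 / c) := by ring
      nlinarith [mul_self_nonneg ‖x i + x j‖]
    have hmB : m * (c * ‖w‖ ^ 2) < m * (c * ε ^ 2) := by
      have h1 := mul_le_mul_of_nonneg_left (hcoer w) hm0.le
      rw [← hBa] at h1
      have h2 := hDa w w
      have h3 := hFN w
      have h4 : c * m * c * ε ^ 2 / 16 * ‖w‖ ^ 2 ≤ c * m * c * ε ^ 2 / 16 * (4 / c) := by
        gcongr
      have h5 : c * m * c * ε ^ 2 / 16 * (4 / c) = c * m * ε ^ 2 / 4 := by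
        field_simp
        ring
      nlinarith [mul_pos (mul_pos hc hm0) (pow_pos hε 2)]
    have h6 : ‖w‖ ^ 2 < ε ^ 2 := lt_of_mul_lt_mul_left
      (lt_of_mul_lt_mul_left hmB hm0.le) hc.le
    exact lt_of_pow_lt_pow_left₀ 2 hε.le h6
  obtain ⟨z, hz⟩ := CompleteSpace.complete hcau
  have hz : Tendsto x (hyperfilter ℕ : Filter ℕ) (𝓝 z) := hz
  have hcont : ∀ E : H →L[ℝ] H →L[ℝ] ℝ,
      Tendsto (fun n => E (x n) (x n)) (hyperfilter ℕ : Filter ℕ) (𝓝 (E z z)) := fun E =>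
    ((by fun_prop : Continuous fun p => E p p).tendsto z).comp hz
  have hNz : N z z = m := tendsto_nhds_unique (hcont N) hNx
  have hDz : D z z = 0 := tendsto_nhds_unique (hcont D) hDx
  have hev : ∀ v, A z v = (1 / m - 1) * N z v := by
    intro v
    have h := bilin_eq_zero_of_nonneg hDs hDpos hDz v
    rw [hDa, hBa] at h
    field_simp
    linarith
  have hκm := hκ (1 / m - 1) ⟨z, by rintro rfl; simp at hNz; exact hm0.ne hNz, hev⟩
  have h1 := hle u
  rw [hBa] at h1
  calc κ * N u u ≤ (1 / m - 1) * N u u := mul_le_mul_of_nonneg_right hκm (hNpos u)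
    _ ≤ A u u := by
      have : (1 / m - 1) * N u u = N u u / m - N u u := by ring
      rw [this, sub_le_iff_le_add, div_le_iff₀ hm0]
      linarith

theorem rayleigh_lower_bound_of_mem {K : Submodule ℝ H} [CompleteSpace K]
    {A N : H →L[ℝ] H →L[ℝ] ℝ} (hA : ∀ u v, A u v = A v u)
    (hN : ∀ u v, N u v = N v u) (hNpos : ∀ u, 0 ≤ N u u) {c : ℝ} (hc : 0 < c)
    (hcoer : ∀ u ∈ K, c * ‖u‖ ^ 2 ≤ A u u + N u u)
    (hcpt : ∀ ε : ℝ, 0 < ε → ∃ (ι : Type) (_ : Fintype ι) (F : ι → (H →L[ℝ] ℝ)),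
      ∀ u ∈ K, N u u ≤ ∑ k, (F k u) ^ 2 + ε * ‖u‖ ^ 2)
    {κ : ℝ} (hκ : ∀ k : ℝ, (∃ u ∈ K, u ≠ 0 ∧ ∀ v ∈ K, A u v = k * N u v) → κ ≤ k)
    {u : H} (hu : u ∈ K) : κ * N u u ≤ A u u := by
  refine rayleigh_lower_bound (H := K) (A := A.bilinearComp K.subtypeL K.subtypeL)
    (N := N.bilinearComp K.subtypeL K.subtypeL) (fun u v => hA u v) (fun u v => hN u v)
    (fun u => hNpos u) hc (fun u => hcoer u u.2) (fun ε hε => ?_) (fun k h => ?_) ⟨u, hu⟩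
  · obtain ⟨ι, hι, F, hF⟩ := hcpt ε hε
    exact ⟨ι, hι, fun k => (F k).comp K.subtypeL, fun u => hF u u.2⟩
  · obtain ⟨u, hu0, hu⟩ := h
    exact hκ k ⟨u, u.2, fun h => hu0 (Subtype.ext h), fun v hv => hu ⟨v, hv⟩⟩

/-- The inhomogeneous Dirichlet problem for a form that is coercive on a closed subspace: the
Lax-Milgram theorem with boundary values in the quotient. -/
theorem existsUnique_of_coercive_of_boundary {K : Submodule ℝ H} [CompleteSpace K]
    (a : H →L[ℝ] H →L[ℝ] ℝ) {c M : ℝ} (hc : 0 < c) (hM : 0 ≤ M)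
    (hbound : ∀ u v, |a u v| ≤ M * ‖u‖ * ‖v‖)
    (hcoer : ∀ u : K, c * ‖u‖ ^ 2 ≤ a u u) (f : StrongDual ℝ K) (g : H ⧸ K) :
    (∃! u : H, (∀ v : K, a u v = -f v) ∧ K.mkQ u = g) ∧
      ∀ u : H, ((∀ v : K, a u v = -f v) ∧ K.mkQ u = g) →
        ‖u‖ ≤ (1 + (M + 1) / c) * (‖g‖ + ‖f‖) := by
  have huniq : ∀ u₁ u₂ : H, ((∀ v : K, a u₁ v = -f v) ∧ K.mkQ u₁ = g) →
      ((∀ v : K, a u₂ v = -f v) ∧ K.mkQ u₂ = g) → u₁ = u₂ := by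
    rintro u₁ u₂ ⟨h1, h1'⟩ ⟨h2, h2'⟩
    have hmem : u₁ - u₂ ∈ K := by
      rw [← Submodule.ker_mkQ K, LinearMap.mem_ker, map_sub, h1', h2', sub_self]
    have h3 := hcoer ⟨u₁ - u₂, hmem⟩
    have h4 : a (u₁ - u₂) (u₁ - u₂) = 0 := by
      have e1 := h1 ⟨u₁ - u₂, hmem⟩
      have e2 := h2 ⟨u₁ - u₂, hmem⟩
      simp only at e1 e2
      rw [map_sub a, sub_apply, e1, e2, sub_self]
    simp only [h4, Submodule.coe_norm] at h3
    have h5 : ‖u₁ - u₂‖ ^ 2 = 0 := by nlinarith [sq_nonneg ‖u₁ - u₂‖]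
    exact sub_eq_zero.1 (by simpa using h5)
  refine ⟨?_, ?_⟩
  -- With a lift `w` of `g`, the unknown `u - w` lies in `K` and solves a problem with data `-f - a
  -- w`, to which Lax-Milgram applies.
  · obtain ⟨w, rfl⟩ := K.mkQ_surjective g
    set aK : K →L[ℝ] K →L[ℝ] ℝ := ((a.comp K.subtypeL).flip.comp K.subtypeL).flip with haK
    have haK' : ∀ u v : K, aK u v = a u v := fun u v => rfl
    have hco : IsCoercive aK := ⟨c, hc, fun u => by
      rw [haK']; have := hcoer u; nlinarith⟩
    set l : StrongDual ℝ K := -f - (a w).comp K.subtypeL with hl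
    set u₀ : K := hco.continuousLinearEquivOfBilin.symm
      ((InnerProductSpace.toDual ℝ K).symm l) with hu₀
    have hsol : ∀ v : K, a u₀ v = -f v - a w v := by
      intro v
      rw [← haK', ← hco.continuousLinearEquivOfBilin_apply, hu₀,
        ContinuousLinearEquiv.apply_symm_apply, InnerProductSpace.toDual_symm_apply]
      rfl
    refine ⟨(u₀ : H) + w, ⟨fun v => ?_, ?_⟩, fun u hu => ?_⟩
    · rw [map_add, add_apply, hsol v]; ring
    · rw [map_add, (by simp : K.mkQ (u₀ : H) = 0), zero_add]
    · refine huniq _ _ hu ⟨fun v => ?_, ?_⟩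
      · rw [map_add, add_apply, hsol v]; ring
      · rw [map_add, (by simp : K.mkQ (u₀ : H) = 0), zero_add]
  · rintro u ⟨hu, hug⟩
    -- The estimate holds for every lift `w`, by testing with `u - w`; the infimum over lifts then
    -- turns `‖w‖` into the quotient norm of `g`.
    have key : ∀ w : H, K.mkQ w = g → ‖u‖ ≤ (1 + (M + 1) / c) * (‖w‖ + ‖f‖) := by
      intro w hw
      have hmem : u - w ∈ K := by
        rw [← Submodule.ker_mkQ K, LinearMap.mem_ker, map_sub, hug, hw, sub_self]
      have h1 := hcoer ⟨u - w, hmem⟩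
      have h2 := hu ⟨u - w, hmem⟩
      simp only [Submodule.coe_norm] at h1 h2
      have h3 : a (u - w) (u - w) = -f ⟨u - w, hmem⟩ - a w (u - w) := by
        rw [map_sub a, sub_apply, h2]
      have h4 : -f ⟨u - w, hmem⟩ ≤ ‖f‖ * ‖u - w‖ :=
        (neg_le_abs _).trans (f.le_opNorm ⟨u - w, hmem⟩)
      have h5 : -(a w (u - w)) ≤ M * ‖w‖ * ‖u - w‖ :=
        (neg_le_abs _).trans (hbound w (u - w))
      have h6 : c * ‖u - w‖ ≤ ‖f‖ + M * ‖w‖ := by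
        rcases (norm_nonneg (u - w)).eq_or_lt with h | h
        · rw [← h, mul_zero]; positivity
        · refine le_of_mul_le_mul_right ?_ h
          nlinarith
      have h7 : ‖u‖ ≤ ‖u - w‖ + ‖w‖ := by
        simpa using norm_add_le (u - w) w
      have h8 : ‖u - w‖ ≤ (‖f‖ + M * ‖w‖) / c := by
        rw [le_div_iff₀ hc]; linarith
      have h9 : (1 + (M + 1) / c) * (‖w‖ + ‖f‖) - ((‖f‖ + M * ‖w‖) / c + ‖w‖)
          = ‖f‖ + (M * ‖f‖ + ‖w‖) / c := by field_simp; ring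
      have h10 : 0 ≤ ‖f‖ + (M * ‖f‖ + ‖w‖) / c := by positivity
      linarith
    have hC : 0 < 1 + (M + 1) / c := by positivity
    refine le_of_forall_pos_le_add fun ε hε => ?_
    obtain ⟨w, hw, hwn⟩ := Submodule.Quotient.norm_mk_lt (S := K) g
      (ε := ε / (1 + (M + 1) / c)) (by positivity)
    refine (key w hw).trans ?_
    calc (1 + (M + 1) / c) * (‖w‖ + ‖f‖)
        ≤ (1 + (M + 1) / c) * ((‖g‖ + ε / (1 + (M + 1) / c)) + ‖f‖) := by gcongr
      _ = _ := by field_simp; ring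

end Abstract

/-! ### Translation estimate in L² -/

section Translation

open scoped ContDiff ENNReal

theorem lintegral_pow_two_le {α : Type*} [MeasurableSpace α] {μ : Measure α}
    [IsProbabilityMeasure μ] {f : α → ℝ≥0∞} (hf : AEMeasurable f μ) :
    (∫⁻ a, f a ∂μ) ^ 2 ≤ ∫⁻ a, f a ^ 2 ∂μ := by
  have h := ENNReal.lintegral_mul_le_Lp_mul_Lq μ Real.HolderConjugate.two_two hf
    (aemeasurable_const (b := (1 : ℝ≥0∞)))
  simp only [Pi.mul_apply, mul_one, ENNReal.rpow_two, one_pow, lintegral_one, measure_univ,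
    ENNReal.one_rpow] at h
  calc (∫⁻ a, f a ∂μ) ^ 2 ≤ ((∫⁻ a, f a ^ 2 ∂μ) ^ (1 / 2 : ℝ)) ^ 2 := by gcongr
    _ = ∫⁻ a, f a ^ 2 ∂μ := by
      rw [← ENNReal.rpow_two, ← ENNReal.rpow_mul]
      norm_num

/-- `‖φ(· + z) - φ‖_{L²} ≤ |z| ‖Dφ‖_{L²}`. -/
theorem lintegral_translate_sub_sq_le {E F : Type*} [NormedAddCommGroup E] [NormedSpace ℝ E]
    [MeasurableSpace E] [BorelSpace E] [SecondCountableTopology E] {μ : Measure E} [SFinite μ]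
    [μ.IsAddRightInvariant] [NormedAddCommGroup F]
    [NormedSpace ℝ F] [CompleteSpace F] {φ : E → F} (hφ : ContDiff ℝ 1 φ) (z : E) :
    ∫⁻ x, ‖φ (x + z) - φ x‖ₑ ^ 2 ∂μ ≤ ‖z‖ₑ ^ 2 * ∫⁻ x, ‖fderiv ℝ φ x‖ₑ ^ 2 ∂μ := by
  have hcont : Continuous (fderiv ℝ φ) := hφ.continuous_fderiv one_ne_zero
  -- Fundamental theorem of calculus on the segment from `x` to `x + z`, then Cauchy-Schwarz in `t`.
  -- Tonelli and translation invariance finish the proof.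
  have hpt : ∀ x, ‖φ (x + z) - φ x‖ₑ ^ 2
      ≤ ∫⁻ t in Icc (0 : ℝ) 1, ‖z‖ₑ ^ 2 * ‖fderiv ℝ φ (x + t • z)‖ₑ ^ 2 := by
    intro x
    set γ : ℝ → F := fun t => φ (x + t • z) with hγ
    have hγc : ContDiff ℝ 1 γ := hφ.comp (by fun_prop)
    have hder : ∀ t, deriv γ t = fderiv ℝ φ (x + t • z) z := by
      intro t
      have h1 : HasDerivAt (fun t : ℝ => x + t • z) z t := by
        simpa using ((hasDerivAt_id t).smul_const z).const_add x
      exact ((hφ.differentiable one_ne_zero _).hasFDerivAt.comp_hasDerivAt t h1).deriv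
    have h := enorm_sub_le_lintegral_deriv_of_contDiffOn_Icc (f := γ) (a := 0) (b := 1)
      hγc.contDiffOn zero_le_one
    have h0 : γ 1 - γ 0 = φ (x + z) - φ x := by simp [hγ]
    rw [h0] at h
    have : IsProbabilityMeasure (volume.restrict (Icc (0 : ℝ) 1)) := ⟨by simp⟩
    calc ‖φ (x + z) - φ x‖ₑ ^ 2 ≤ (∫⁻ t in Icc (0 : ℝ) 1, ‖deriv γ t‖ₑ) ^ 2 := by gcongr
      _ ≤ ∫⁻ t in Icc (0 : ℝ) 1, ‖deriv γ t‖ₑ ^ 2 :=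
        lintegral_pow_two_le (hγc.continuous_deriv le_rfl).enorm.aemeasurable
      _ ≤ _ := by
        refine lintegral_mono fun t => ?_
        rw [hder, ← mul_pow, mul_comm]
        gcongr
        exact ContinuousLinearMap.le_opENorm _ _
  have hmeas : Measurable (fun p : E × ℝ => ‖z‖ₑ ^ 2 * ‖fderiv ℝ φ (p.1 + p.2 • z)‖ₑ ^ 2) := by
    have : Continuous (fun p : E × ℝ => fderiv ℝ φ (p.1 + p.2 • z)) := hcont.comp (by fun_prop)
    exact (this.enorm.measurable.pow_const 2).const_mul _
  calc ∫⁻ x, ‖φ (x + z) - φ x‖ₑ ^ 2 ∂μ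
      ≤ ∫⁻ x, (∫⁻ t in Icc (0 : ℝ) 1, ‖z‖ₑ ^ 2 * ‖fderiv ℝ φ (x + t • z)‖ₑ ^ 2) ∂μ :=
        lintegral_mono hpt
    _ = ∫⁻ t in Icc (0 : ℝ) 1, (∫⁻ x, ‖z‖ₑ ^ 2 * ‖fderiv ℝ φ (x + t • z)‖ₑ ^ 2 ∂μ) :=
        lintegral_lintegral_swap hmeas.aemeasurable
    _ = ∫⁻ _t in Icc (0 : ℝ) 1, (‖z‖ₑ ^ 2 * ∫⁻ x, ‖fderiv ℝ φ x‖ₑ ^ 2 ∂μ) := by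
        refine lintegral_congr fun t => ?_
        rw [lintegral_add_right_eq_self (fun x => ‖z‖ₑ ^ 2 * ‖fderiv ℝ φ x‖ₑ ^ 2) (t • z),
          lintegral_const_mul _ (hcont.enorm.measurable.pow_const 2)]
    _ = _ := by simp

end Translation

/-! ### Grids of cubes and a quantitative Rellich inequality -/

section Cubes

open scoped ContDiff ENNReal

/-- The cube of side `h` with corner `h k`. -/
def cube (h : ℝ) (k : Fin 3 → ℤ) : Set E3 := {x | ∀ i, ⌊x i / h⌋ = k i}

theorem measurableSet_cube (h : ℝ) (k : Fin 3 → ℤ) : MeasurableSet (cube h k) := by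
  have : cube h k = ⋂ i, (fun x : E3 => ⌊x i / h⌋) ⁻¹' {k i} := by
    ext x; simp [cube]
  rw [this]
  refine MeasurableSet.iInter fun i => ?_
  have hm : Measurable (fun x : E3 => x i / h) := by fun_prop
  exact (Int.measurable_floor.comp hm) (measurableSet_singleton _)

theorem pairwiseDisjoint_cube (h : ℝ) (s : Set (Fin 3 → ℤ)) : s.PairwiseDisjoint (cube h) := by
  intro k _ l _ hkl
  refine Set.disjoint_left.2 fun x hx hx' => hkl ?_
  funext i
  rw [← hx i, ← hx' i]

theorem volume_cube {h : ℝ} (hh : 0 < h) (k : Fin 3 → ℤ) :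
    volume (cube h k) = ENNReal.ofReal (h ^ 3) := by
  have : cube h k = (WithLp.ofLp : E3 → (Fin 3 → ℝ)) ⁻¹'
      (Set.pi univ fun i => Ico (h * k i) (h * (k i + 1))) := by
    ext x
    simp only [cube, mem_ofPred_eq, mem_preimage, mem_pi, mem_univ, true_imp_iff, mem_Ico,
      Int.floor_eq_iff, le_div_iff₀ hh, div_lt_iff₀ hh]
    simp only [mul_comm h]
  rw [this, (PiLp.volume_preserving_ofLp (Fin 3)).measure_preimage
    (MeasurableSet.univ_pi fun i => measurableSet_Ico).nullMeasurableSet, Real.volume_pi_Ico,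
    ENNReal.ofReal_pow hh.le]
  simp only [Fin.prod_univ_three]
  have : ∀ i, h * ((k i : ℝ) + 1) - h * k i = h := fun i => by ring
  simp only [this]
  ring

/-- The open cube of side `2 h` around the origin. -/
def centeredCube (h : ℝ) : Set E3 := {z | ∀ i, z i ∈ Ioo (-h) h}

theorem measurableSet_centeredCube (h : ℝ) : MeasurableSet (centeredCube h) := by
  have : centeredCube h = ⋂ i, (fun x : E3 => x i) ⁻¹' (Ioo (-h) h) := by
    ext x; simp [centeredCube]
  rw [this]
  refine MeasurableSet.iInter fun i => ?_
  have hm : Measurable (fun x : E3 => x i) := by fun_prop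
  exact hm measurableSet_Ioo

theorem volume_centeredCube {h : ℝ} (hh : 0 < h) :
    volume (centeredCube h) = ENNReal.ofReal (8 * h ^ 3) := by
  have : centeredCube h = (WithLp.ofLp : E3 → (Fin 3 → ℝ)) ⁻¹'
      (Set.pi univ fun _ => Ioo (-h) h) := by
    ext x
    simp [centeredCube]
  rw [this, (PiLp.volume_preserving_ofLp (Fin 3)).measure_preimage
    (MeasurableSet.univ_pi fun i => measurableSet_Ioo).nullMeasurableSet, Real.volume_pi_Ioo,
    Fin.prod_univ_three, ← ENNReal.ofReal_mul (by linarith), ← ENNReal.ofReal_mul (by nlinarith)]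
  congr 1
  ring

theorem norm_sq_le_of_mem_centeredCube {h : ℝ} {z : E3} (hz : z ∈ centeredCube h) :
    ‖z‖ ^ 2 ≤ 3 * h ^ 2 := by
  rw [EuclideanSpace.norm_sq_eq, Fin.sum_univ_three]
  have : ∀ i, ‖z i‖ ^ 2 ≤ h ^ 2 := fun i => by
    rw [Real.norm_eq_abs, sq_abs]
    have := hz i
    nlinarith [this.1, this.2]
  linarith [this 0, this 1, this 2]

theorem sub_mem_centeredCube {h : ℝ} (hh : 0 < h) {k : Fin 3 → ℤ} {x z : E3}
    (hx : x ∈ cube h k) (hz : x + z ∈ cube h k) : z ∈ centeredCube h := by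
  intro i
  have h1 := (Int.floor_eq_iff.1 (hx i))
  have h2 := (Int.floor_eq_iff.1 (hz i))
  rw [le_div_iff₀ hh, div_lt_iff₀ hh] at h1 h2
  simp only [PiLp.add_apply] at h2
  constructor <;> nlinarith [h1.1, h1.2, h2.1, h2.2]

/-- A bounded set meets finitely many cubes. -/
theorem exists_finset_cube_cover {Ω : Set E3} (hΩ : Bornology.IsBounded Ω) (h : ℝ) :
    ∃ s : Finset (Fin 3 → ℤ), Ω ⊆ ⋃ k ∈ s, cube h k := by
  obtain ⟨R, hR⟩ := hΩ.exists_norm_le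
  have hfin : (Set.pi univ fun _ : Fin 3 => Icc (⌊-(R / |h|)⌋) (⌊R / |h|⌋)).Finite :=
    Set.Finite.pi fun _ => Set.finite_Icc _ _
  refine ⟨hfin.toFinset, fun x hx => ?_⟩
  simp only [mem_iUnion, Set.Finite.mem_toFinset]
  refine ⟨fun i => ⌊x i / h⌋, ?_, fun i => rfl⟩
  intro i _
  have h1 : |x i / h| ≤ R / |h| := by
    rw [abs_div]
    gcongr
    exact (PiLp.norm_apply_le x i).trans (hR x hx)
  exact ⟨Int.floor_mono (abs_le.1 h1).1, Int.floor_mono (abs_le.1 h1).2⟩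

/-- `μ(univ) ∫ ‖φ‖² = ‖∫ φ‖² + ½ ∬ ‖φ(x) - φ(y)‖²`. -/
theorem integral_norm_sq_eq_add_integral_sub {α F : Type*} [MeasurableSpace α]
    [NormedAddCommGroup F] [InnerProductSpace ℝ F] [CompleteSpace F] {μ : Measure α}
    [IsFiniteMeasure μ] {φ : α → F} (hφ : MemLp φ 2 μ) :
    μ.real univ * ∫ x, ‖φ x‖ ^ 2 ∂μ
      = ‖∫ x, φ x ∂μ‖ ^ 2 + 1 / 2 * ∫ p, ‖φ p.1 - φ p.2‖ ^ 2 ∂(μ.prod μ) := by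
  have hi : Integrable φ μ := hφ.integrable one_le_two
  have h2 : Integrable (fun x => ‖φ x‖ ^ 2) μ := hφ.integrable_norm_pow two_ne_zero
  have i1 : Integrable (fun p : α × α => ‖φ p.1‖ ^ 2) (μ.prod μ) := h2.comp_fst μ
  have i2 : Integrable (fun p : α × α => ‖φ p.2‖ ^ 2) (μ.prod μ) := h2.comp_snd μ
  have i3 : Integrable (fun p : α × α => inner ℝ (φ p.1) (φ p.2)) (μ.prod μ) := by
    refine Integrable.mono' (hi.norm.mul_prod hi.norm) ?_ (Filter.Eventually.of_forall fun p =>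
      norm_inner_le_norm _ _)
    exact hi.1.comp_fst.inner hi.1.comp_snd
  have e : ∫ p, ‖φ p.1 - φ p.2‖ ^ 2 ∂(μ.prod μ)
      = ∫ p, ‖φ p.1‖ ^ 2 ∂(μ.prod μ) - 2 * ∫ p, inner ℝ (φ p.1) (φ p.2) ∂(μ.prod μ)
        + ∫ p, ‖φ p.2‖ ^ 2 ∂(μ.prod μ) := by
    rw [← integral_const_mul, ← integral_sub i1 (i3.const_mul 2)]
    refine Eq.trans ?_ (integral_add (i1.sub (i3.const_mul 2)) i2)
    exact integral_congr_ae (Filter.Eventually.of_forall fun p => norm_sub_sq_real _ _)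
  have e1 : ∫ p, ‖φ p.1‖ ^ 2 ∂(μ.prod μ) = μ.real univ * ∫ x, ‖φ x‖ ^ 2 ∂μ := by
    rw [integral_fun_fst (fun x => ‖φ x‖ ^ 2), smul_eq_mul]
  have e2 : ∫ p, ‖φ p.2‖ ^ 2 ∂(μ.prod μ) = μ.real univ * ∫ x, ‖φ x‖ ^ 2 ∂μ := by
    rw [integral_fun_snd (fun x => ‖φ x‖ ^ 2), smul_eq_mul]
  have e3 : ∫ p, inner ℝ (φ p.1) (φ p.2) ∂(μ.prod μ) = ‖∫ x, φ x ∂μ‖ ^ 2 := by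
    rw [integral_prod _ i3]
    simp only [integral_inner hi]
    have : ∀ x, inner ℝ (φ x) (∫ y, φ y ∂μ) = inner ℝ (∫ y, φ y ∂μ) (φ x) :=
      fun x => real_inner_comm _ _
    simp only [this]
    rw [integral_inner hi, real_inner_self_eq_norm_sq]
  rw [e, e1, e2, e3]
  ring

/-- With `y = x + z`, two points of one cube differ by some `z` in the centred cube. After enlarging
the domains and exchanging the integrals, the translation estimate applies for each `z`; the
constant is the volume `8 h³` times the bound `3 h²` for `|z|²`. -/
theorem sum_lintegral_cube_sub_sq_le {F : Type*} [NormedAddCommGroup F]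
    [NormedSpace ℝ F] [CompleteSpace F] {φ : E3 → F} (hφ : ContDiff ℝ 1 φ) {h : ℝ} (hh : 0 < h)
    (s : Finset (Fin 3 → ℤ)) :
    ∑ k ∈ s, ∫⁻ x in cube h k, ∫⁻ y in cube h k, ‖φ x - φ y‖ₑ ^ 2
      ≤ ENNReal.ofReal (24 * h ^ 5) * ∫⁻ x, ‖fderiv ℝ φ x‖ₑ ^ 2 := by
  have hc : Continuous φ := hφ.continuous
  have step : ∀ k, ∫⁻ x in cube h k, ∫⁻ y in cube h k, ‖φ x - φ y‖ₑ ^ 2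
      ≤ ∫⁻ x in cube h k, ∫⁻ z in centeredCube h, ‖φ (x + z) - φ x‖ₑ ^ 2 := by
    intro k
    refine setLIntegral_mono' (measurableSet_cube h k) fun x hx => ?_
    rw [← lintegral_indicator (measurableSet_cube h k),
      ← lintegral_indicator (measurableSet_centeredCube h),
      ← lintegral_add_left_eq_self _ x]
    refine lintegral_mono fun z => ?_
    by_cases hz : x + z ∈ cube h k
    · rw [indicator_of_mem hz, indicator_of_mem (sub_mem_centeredCube hh hx hz), enorm_sub_rev]
    · rw [indicator_of_notMem hz]
      exact zero_le
  have hm : Measurable (fun p : E3 × E3 => ‖φ (p.1 + p.2) - φ p.1‖ₑ ^ 2) := by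
    have : Continuous (fun p : E3 × E3 => φ (p.1 + p.2) - φ p.1) := by fun_prop
    exact this.enorm.measurable.pow_const 2
  calc ∑ k ∈ s, ∫⁻ x in cube h k, ∫⁻ y in cube h k, ‖φ x - φ y‖ₑ ^ 2
      ≤ ∑ k ∈ s, ∫⁻ x in cube h k, ∫⁻ z in centeredCube h, ‖φ (x + z) - φ x‖ₑ ^ 2 :=
        Finset.sum_le_sum fun k _ => step k
    _ = ∫⁻ x in ⋃ k ∈ s, cube h k, ∫⁻ z in centeredCube h, ‖φ (x + z) - φ x‖ₑ ^ 2 :=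
        (lintegral_biUnion_finset (pairwiseDisjoint_cube h _)
          (fun k _ => measurableSet_cube h k) _).symm
    _ ≤ ∫⁻ x, ∫⁻ z in centeredCube h, ‖φ (x + z) - φ x‖ₑ ^ 2 := setLIntegral_le_lintegral _ _
    _ = ∫⁻ z in centeredCube h, ∫⁻ x, ‖φ (x + z) - φ x‖ₑ ^ 2 :=
        lintegral_lintegral_swap hm.aemeasurable
    _ ≤ ∫⁻ _z in centeredCube h, ENNReal.ofReal (3 * h ^ 2) * ∫⁻ x, ‖fderiv ℝ φ x‖ₑ ^ 2 := by
        refine setLIntegral_mono' (measurableSet_centeredCube h) fun z hz => ?_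
        refine (lintegral_translate_sub_sq_le hφ z).trans ?_
        gcongr
        rw [← ofReal_norm, ← ENNReal.ofReal_pow (norm_nonneg z)]
        exact ENNReal.ofReal_le_ofReal (norm_sq_le_of_mem_centeredCube hz)
    _ = ENNReal.ofReal (24 * h ^ 5) * ∫⁻ x, ‖fderiv ℝ φ x‖ₑ ^ 2 := by
        rw [setLIntegral_const, volume_centeredCube hh, mul_right_comm,
          ← ENNReal.ofReal_mul (by positivity)]
        congr 2
        ring

/-- A quantitative form of the Rellich theorem: up to a small multiple of the Dirichlet integral,
the `L²` norm is controlled by the mean values over the cubes of a grid. -/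
theorem integral_norm_sq_le_sum_cube {F : Type*} [NormedAddCommGroup F]
    [InnerProductSpace ℝ F] [CompleteSpace F] {φ : E3 → F} (hφ : ContDiff ℝ 1 φ)
    (hsupp : HasCompactSupport φ) {h : ℝ} (hh : 0 < h) {s : Finset (Fin 3 → ℤ)}
    (hs : Function.support φ ⊆ ⋃ k ∈ s, cube h k) :
    ∫ x, ‖φ x‖ ^ 2 ≤ ∑ k ∈ s, (h ^ 3)⁻¹ * ‖∫ x in cube h k, φ x‖ ^ 2
      + 12 * h ^ 2 * ∫ x, ‖fderiv ℝ φ x‖ ^ 2 := by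
  have hc : Continuous φ := hφ.continuous
  have hL : MemLp φ 2 volume := hc.memLp_of_hasCompactSupport hsupp
  have hDL : MemLp (fderiv ℝ φ) 2 volume :=
    (hφ.continuous_fderiv one_ne_zero).memLp_of_hasCompactSupport (hsupp.fderiv ℝ)
  have hfin : ∀ k, IsFiniteMeasure (volume.restrict (cube h k)) := fun k =>
    ⟨by rw [Measure.restrict_apply_univ, volume_cube hh]; exact ENNReal.ofReal_lt_top⟩
  have hvol : ∀ k, (volume.restrict (cube h k)).real univ = h ^ 3 := fun k => by
    rw [measureReal_restrict_apply_univ, Measure.real, volume_cube hh,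
      ENNReal.toReal_ofReal (by positivity)]
  set I : (Fin 3 → ℤ) → ℝ := fun k => ∫ p, ‖φ p.1 - φ p.2‖ ^ 2
    ∂((volume.restrict (cube h k)).prod (volume.restrict (cube h k))) with hI
  -- The variance identity on one cube. Its factor `(2 h³)⁻¹` against `24 h⁵` gives the final `12
  -- h²`.
  have hone : ∀ k, ∫ x in cube h k, ‖φ x‖ ^ 2
      = (h ^ 3)⁻¹ * ‖∫ x in cube h k, φ x‖ ^ 2 + (2 * h ^ 3)⁻¹ * I k := by
    intro k
    have h1 := integral_norm_sq_eq_add_integral_sub (hL.restrict (cube h k))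
    rw [hvol] at h1
    field_simp
    linarith
  have hsum : ∫ x, ‖φ x‖ ^ 2 = ∑ k ∈ s, ∫ x in cube h k, ‖φ x‖ ^ 2 := by
    rw [← integral_biUnion_finset s (fun k _ => measurableSet_cube h k)
      (pairwiseDisjoint_cube h _)
      (fun k _ => (hL.integrable_norm_pow two_ne_zero).integrableOn)]
    refine (setIntegral_eq_integral_of_forall_compl_eq_zero fun x hx => ?_).symm
    have : φ x = 0 := by
      by_contra hne
      exact hx (hs hne)
    simp [this]
  have hIint : ∀ k, Integrable (fun p : E3 × E3 => ‖φ p.1 - φ p.2‖ ^ 2)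
      ((volume.restrict (cube h k)).prod (volume.restrict (cube h k))) := by
    intro k
    have hL' := hL.restrict (cube h k)
    exact ((hL'.comp_fst _).sub (hL'.comp_snd _)).integrable_norm_pow two_ne_zero
  have hIle : ∑ k ∈ s, I k ≤ 24 * h ^ 5 * ∫ x, ‖fderiv ℝ φ x‖ ^ 2 := by
    have hnn : 0 ≤ ∫ x, ‖fderiv ℝ φ x‖ ^ 2 := integral_nonneg fun x => by positivity
    rw [← ENNReal.ofReal_le_ofReal_iff (by positivity), ENNReal.ofReal_mul (by positivity),
      ENNReal.ofReal_sum_of_nonneg (fun k _ => integral_nonneg fun p => by positivity),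
      ofReal_integral_eq_lintegral_ofReal (hDL.integrable_norm_pow two_ne_zero)
        (Filter.Eventually.of_forall fun x => by positivity)]
    have hD : ∀ x, ENNReal.ofReal (‖fderiv ℝ φ x‖ ^ 2) = ‖fderiv ℝ φ x‖ₑ ^ 2 := fun x => by
      rw [ENNReal.ofReal_pow (norm_nonneg _), ofReal_norm]
    simp only [hD]
    refine le_trans (Finset.sum_le_sum fun k _ => ?_) (sum_lintegral_cube_sub_sq_le hφ hh s)
    rw [ofReal_integral_eq_lintegral_ofReal (hIint k)
      (Filter.Eventually.of_forall fun x => by positivity), lintegral_prod]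
    · refine le_of_eq (lintegral_congr fun x => lintegral_congr fun y => ?_)
      rw [ENNReal.ofReal_pow (norm_nonneg _), ofReal_norm]
    · exact (hIint k).1.aemeasurable.ennreal_ofReal
  rw [hsum, Finset.sum_congr rfl fun k _ => hone k, Finset.sum_add_distrib]
  gcongr
  calc ∑ k ∈ s, (2 * h ^ 3)⁻¹ * I k
      ≤ (2 * h ^ 3)⁻¹ * (24 * h ^ 5 * ∫ x, ‖fderiv ℝ φ x‖ ^ 2) := by
        rw [← Finset.mul_sum]
        gcongr
    _ = _ := by field_simp; ring

end Cubes

/-! ### Scalar components of L² fields -/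

section Components

variable {Ω : Set E3} {ι : Type*} [Fintype ι]

/-- The `k`-th component of a square integrable field. -/
def component (Ω : Set E3) (k : ι) : L2 Ω (EuclideanSpace ℝ ι) →L[ℝ] L2 Ω ℝ :=
  (EuclideanSpace.proj (𝕜 := ℝ) k).compLpL 2 (volume.restrict Ω)

theorem coeFn_component (k : ι) (w : L2 Ω (EuclideanSpace ℝ ι)) :
    component Ω k w =ᵐ[volume.restrict Ω] fun x => w x k :=
  ContinuousLinearMap.coeFn_compLpL _ _

theorem inner_L2_eq_integral (f g : L2 Ω ℝ) : inner ℝ f g = ∫ x in Ω, f x * g x := by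
  rw [L2.inner_def]
  refine integral_congr_ae (Filter.Eventually.of_forall fun x => ?_)
  simp [mul_comm]

theorem norm_sq_eq_sum_component (w : L2 Ω (EuclideanSpace ℝ ι)) :
    ‖w‖ ^ 2 = ∑ k, ‖component Ω k w‖ ^ 2 := by
  simp only [← real_inner_self_eq_norm_sq, inner_L2_eq_integral]
  rw [L2.inner_def, ← integral_finsetSum _ fun k _ => ?_]
  · refine integral_congr_ae ?_
    have h : ∀ᵐ x ∂(volume.restrict Ω), ∀ k, component Ω k w x = w x k :=
      MeasureTheory.ae_all_iff.2 fun k => coeFn_component k w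
    filter_upwards [h] with x hx
    simp only [hx, real_inner_self_eq_norm_sq, EuclideanSpace.norm_sq_eq, Real.norm_eq_abs, sq_abs]
    exact Finset.sum_congr rfl fun k _ => sq _
  · exact (Lp.memLp (component Ω k w)).integrable_mul (Lp.memLp (component Ω k w))

theorem integral_component_mul (k : ι) (w : L2 Ω (EuclideanSpace ℝ ι)) {ψ : E3 → ℝ}
    (hψ : MemLp ψ 2 (volume.restrict Ω)) :
    ∫ x in Ω, w x k * ψ x = inner ℝ (component Ω k w) (hψ.toLp ψ) := by
  rw [inner_L2_eq_integral]
  refine integral_congr_ae ?_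
  filter_upwards [coeFn_component k w, hψ.coeFn_toLp] with x h1 h2
  rw [h1, h2]

end Components

/-! ### H¹ and H¹₀: completeness, density, the Korn identity, compactness -/

section Sobolev

open scoped ContDiff ENNReal

variable {Ω : Set E3}

/-- Each test identity equates two inner products against fixed L² functions, hence is a closed
condition on the pair (field, gradient). -/
theorem isClosed_H1 (Ω : Set E3) : IsClosed (H1 Ω : Set (WithLp 2 (L2 Ω E3 × L2 Ω M33))) := by
  have : (H1 Ω : Set (WithLp 2 (L2 Ω E3 × L2 Ω M33))) =
      ⋂ (φ : E3 → ℝ) (hφ : IsTestFunction Ω φ) (i : Fin 3) (j : Fin 3),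
        {p | inner ℝ (component Ω i p.fst) ((hφ.memLp_pderiv j).toLp _)
          = -inner ℝ (component Ω (i, j) p.snd) (hφ.memLp.toLp _)} := by
    ext p
    simp only [mem_iInter, mem_ofPred_eq, ← integral_component_mul]
    rfl
  rw [this]
  refine isClosed_iInter fun φ => isClosed_iInter fun hφ => isClosed_iInter fun i =>
    isClosed_iInter fun j => isClosed_eq ?_ ?_
  · have : Continuous fun p : WithLp 2 (L2 Ω E3 × L2 Ω M33) => p.fst := by fun_prop
    fun_prop
  · have : Continuous fun p : WithLp 2 (L2 Ω E3 × L2 Ω M33) => p.snd := by fun_prop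
    fun_prop

instance instCompleteSpaceH1 (Ω : Set E3) : CompleteSpace (H1 Ω) :=
  (isClosed_H1 Ω).completeSpace_coe

instance instCompleteSpaceH10 (Ω : Set E3) : CompleteSpace (H10 Ω) :=
  (smoothCompact Ω).isClosed_topologicalClosure.completeSpace_coe

/-- The `i`-th component of a field in `H¹`. -/
def fldComp (Ω : Set E3) (i : Fin 3) : H1 Ω →L[ℝ] L2 Ω ℝ :=
  (component Ω i).comp ((WithLp.fstL 2 ℝ (L2 Ω E3) (L2 Ω M33)).comp (H1 Ω).subtypeL)

/-- The entry `∂_j u_i` of the weak gradient of a field in `H¹`. -/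
def gradComp (Ω : Set E3) (i j : Fin 3) : H1 Ω →L[ℝ] L2 Ω ℝ :=
  (component Ω (i, j)).comp ((WithLp.sndL 2 ℝ (L2 Ω E3) (L2 Ω M33)).comp (H1 Ω).subtypeL)

theorem coeFn_fldComp (i : Fin 3) (u : H1 Ω) :
    fldComp Ω i u =ᵐ[volume.restrict Ω] fun x => fld u x i :=
  coeFn_component i u.1.fst

theorem coeFn_gradComp (i j : Fin 3) (u : H1 Ω) :
    gradComp Ω i j u =ᵐ[volume.restrict Ω] fun x => grad u x i j :=
  coeFn_component (i, j) u.1.snd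

/-- `‖∇u‖²`. -/
def gradSq (u : H1 Ω) : ℝ := ∑ i, ∑ j, ‖gradComp Ω i j u‖ ^ 2

/-- `‖u‖²_{L²}`. -/
def fldSq (u : H1 Ω) : ℝ := ∑ i, ‖fldComp Ω i u‖ ^ 2

theorem gradSq_nonneg (u : H1 Ω) : 0 ≤ gradSq u :=
  Finset.sum_nonneg fun _ _ => Finset.sum_nonneg fun _ _ => by positivity

theorem fldSq_nonneg (u : H1 Ω) : 0 ≤ fldSq u := Finset.sum_nonneg fun _ _ => by positivity

theorem norm_sq_eq_fldSq_add_gradSq (u : H1 Ω) : ‖u‖ ^ 2 = fldSq u + gradSq u := by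
  have h : ‖u‖ ^ 2 = ‖u.1.fst‖ ^ 2 + ‖u.1.snd‖ ^ 2 := by
    rw [Submodule.coe_norm, WithLp.prod_norm_sq_eq_of_L2]
  rw [h, norm_sq_eq_sum_component, norm_sq_eq_sum_component, Fintype.sum_prod_type]
  rfl

theorem norm_fldComp_le (i : Fin 3) (u : H1 Ω) : ‖fldComp Ω i u‖ ≤ ‖u‖ := by
  refine le_of_sq_le_sq ?_ (norm_nonneg u)
  have h1 : ‖fldComp Ω i u‖ ^ 2 ≤ fldSq u :=
    Finset.single_le_sum (f := fun k => ‖fldComp Ω k u‖ ^ 2) (fun _ _ => by positivity)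
      (Finset.mem_univ i)
  have := gradSq_nonneg u
  rw [norm_sq_eq_fldSq_add_gradSq]
  linarith

theorem norm_gradComp_le (i j : Fin 3) (u : H1 Ω) : ‖gradComp Ω i j u‖ ≤ ‖u‖ := by
  refine le_of_sq_le_sq ?_ (norm_nonneg u)
  have h1 : ‖gradComp Ω i j u‖ ^ 2 ≤ ∑ l, ‖gradComp Ω i l u‖ ^ 2 :=
    Finset.single_le_sum (f := fun k => ‖gradComp Ω i k u‖ ^ 2) (fun _ _ => by positivity)
      (Finset.mem_univ j)
  have h2 : ∑ l, ‖gradComp Ω i l u‖ ^ 2 ≤ gradSq u :=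
    Finset.single_le_sum (f := fun k => ∑ l, ‖gradComp Ω k l u‖ ^ 2)
      (fun _ _ => Finset.sum_nonneg fun _ _ => by positivity) (Finset.mem_univ i)
  have := fldSq_nonneg u
  rw [norm_sq_eq_fldSq_add_gradSq]
  linarith

theorem IsTestFunction.eq_zero_of_notMem {F : Type*} [NormedAddCommGroup F] [NormedSpace ℝ F]
    {φ : E3 → F} (h : IsTestFunction Ω φ) {x : E3} (hx : x ∉ Ω) : φ x = 0 :=
  image_eq_zero_of_notMem_tsupport fun hx' => hx (h.tsupport_subset hx')

theorem IsTestFunction.pderiv {φ : E3 → ℝ} (h : IsTestFunction Ω φ) (j : Fin 3) :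
    IsTestFunction Ω (pderiv j φ) where
  contDiff := (h.contDiff.fderiv_right (m := ∞) (by simp)).clm_apply contDiff_const
  hasCompactSupport := h.hasCompactSupport.fderiv_apply (𝕜 := ℝ) _
  tsupport_subset := (tsupport_fderiv_apply_subset ℝ _).trans h.tsupport_subset

theorem IsTestFunction.component {φ : E3 → E3} (h : IsTestFunction Ω φ) (i : Fin 3) :
    IsTestFunction Ω (fun x => φ x i) where
  contDiff := (EuclideanSpace.proj (𝕜 := ℝ) i).contDiff.comp h.contDiff
  hasCompactSupport := h.hasCompactSupport.comp_left (g := fun y : E3 => y i) rfl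
  tsupport_subset := (tsupport_comp_subset (g := fun y : E3 => y i) rfl φ).trans h.tsupport_subset

theorem IsTestFunction.integrable_mul {φ ψ : E3 → ℝ} (hφ : IsTestFunction Ω φ)
    (hψ : IsTestFunction Ω ψ) : Integrable (fun x => φ x * ψ x) :=
  (hφ.contDiff.continuous.mul hψ.contDiff.continuous).integrable_of_hasCompactSupport
    hφ.hasCompactSupport.mul_right

theorem integral_mul_pderiv {φ ψ : E3 → ℝ} (hφ : IsTestFunction Ω φ) (hψ : IsTestFunction Ω ψ)
    (j : Fin 3) : ∫ x, φ x * pderiv j ψ x = -∫ x, pderiv j φ x * ψ x :=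
  integral_mul_fderiv_eq_neg_fderiv_mul_of_integrable ((hφ.pderiv j).integrable_mul hψ)
    (hφ.integrable_mul (hψ.pderiv j)) (hφ.integrable_mul hψ)
    (fun x _ => hφ.contDiff.differentiable (by simp) x)
    (fun x _ => hψ.contDiff.differentiable (by simp) x)

theorem pderiv_comm {φ : E3 → ℝ} (hφ : IsTestFunction Ω φ) (i j : Fin 3) :
    pderiv i (pderiv j φ) = pderiv j (pderiv i φ) := by
  have hd : Differentiable ℝ (fderiv ℝ φ) :=
    (hφ.contDiff.fderiv_right (m := ∞) (by simp)).differentiable (by simp)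
  have hs : ∀ (k l : Fin 3) (x : E3), pderiv k (pderiv l φ) x
      = fderiv ℝ (fderiv ℝ φ) x (EuclideanSpace.single k 1) (EuclideanSpace.single l 1) := by
    intro k l x
    have : pderiv l φ = fun y => fderiv ℝ φ y (EuclideanSpace.single l 1) := rfl
    rw [Elasticity.pderiv, this, fderiv_clm_apply (hd x) (differentiableAt_const _)]
    simp
  funext x
  rw [hs, hs]
  exact (hφ.contDiff.contDiffAt.isSymmSndFDerivAt (n := ∞) (by
    rw [minSmoothness_of_isRCLikeNormedField]; exact WithTop.coe_le_coe.2 le_top)) _ _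

/-- Both sides equal `-∫ φ ∂_i ∂_j ψ`. -/
theorem integral_pderiv_mul_pderiv_swap {φ ψ : E3 → ℝ} (hφ : IsTestFunction Ω φ)
    (hψ : IsTestFunction Ω ψ) (i j : Fin 3) :
    ∫ x, pderiv j φ x * pderiv i ψ x = ∫ x, pderiv i φ x * pderiv j ψ x := by
  have h1 := integral_mul_pderiv hφ (hψ.pderiv i) j
  have h2 := integral_mul_pderiv hφ (hψ.pderiv j) i
  rw [pderiv_comm hψ] at h1
  linarith

/-- The weak gradient of a test field is its classical gradient. -/
theorem exists_test_of_mem_smoothCompact (hΩ : IsOpen Ω) {u : H1 Ω} (hu : u ∈ smoothCompact Ω) :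
    ∃ φ : Fin 3 → E3 → ℝ, (∀ i, IsTestFunction Ω (φ i)) ∧
      (∀ i, fldComp Ω i u =ᵐ[volume.restrict Ω] φ i) ∧
      ∀ i j, gradComp Ω i j u =ᵐ[volume.restrict Ω] pderiv j (φ i) := by
  obtain ⟨φ, hφ, hφu⟩ := hu
  have hfld : ∀ i, fldComp Ω i u =ᵐ[volume.restrict Ω] fun x => φ x i := by
    intro i
    filter_upwards [coeFn_fldComp i u, hφu] with x h1 h2
    rw [h1, h2]
  refine ⟨fun i x => φ x i, hφ.component, hfld, fun i j => ?_⟩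
  have hφi := hφ.component i
  have hdiff : MemLp (fun x => gradComp Ω i j u x - pderiv j (fun x => φ x i) x) 2
      (volume.restrict Ω) := (Lp.memLp (gradComp Ω i j u)).sub (hφi.memLp_pderiv j)
  have hloc : LocallyIntegrableOn
      (fun x => gradComp Ω i j u x - pderiv j (fun x => φ x i) x) Ω volume :=
    locallyIntegrableOn_of_locallyIntegrable_restrict (hdiff.locallyIntegrable one_le_two)
  -- Fundamental lemma of the calculus of variations: weak and classical derivative have the same
  -- integral against every test function.
  have h0 := hΩ.ae_eq_zero_of_integral_contDiff_smul_eq_zero hloc (by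
    intro g hg hgc hgs
    have hgt : IsTestFunction Ω g := ⟨hg, hgc, hgs⟩
    have hset : ∀ F : E3 → ℝ, (∀ x, x ∉ Ω → F x = 0) → ∫ x, F x = ∫ x in Ω, F x := fun F hF =>
      (setIntegral_eq_integral_of_forall_compl_eq_zero fun x hx => hF x hx).symm
    have hI1 : Integrable (fun x => g x * gradComp Ω i j u x) (volume.restrict Ω) :=
      hgt.memLp.integrable_mul (Lp.memLp (gradComp Ω i j u))
    have hI2 : Integrable (fun x => g x * pderiv j (fun x => φ x i) x) (volume.restrict Ω) :=
      hgt.memLp.integrable_mul (hφi.memLp_pderiv j)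
    rw [hset _ fun x hx => by simp [hgt.eq_zero_of_notMem hx]]
    simp only [smul_eq_mul, mul_sub]
    rw [integral_sub hI1 hI2]
    have e1 : ∫ x in Ω, g x * gradComp Ω i j u x = ∫ x in Ω, u.1.snd x (i, j) * g x := by
      refine integral_congr_ae ?_
      filter_upwards [coeFn_component (i, j) u.1.snd] with x hx
      rw [mul_comm, ← hx]
      rfl
    have e2 : ∫ x in Ω, u.1.fst x i * pderiv j g x = ∫ x in Ω, φ x i * pderiv j g x := by
      refine integral_congr_ae ?_
      filter_upwards [hφu] with x hx
      rw [← hx]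
      rfl
    have e3 := u.2 g hgt i j
    have e4 := integral_mul_pderiv hφi hgt j
    rw [hset _ fun x hx => by simp [hφi.eq_zero_of_notMem hx],
      hset _ fun x hx => by simp [hgt.eq_zero_of_notMem hx]] at e4
    simp only [mul_comm (g _)] at e1 ⊢
    rw [e1]
    linarith)
  rw [Filter.EventuallyEq, ae_restrict_iff' hΩ.measurableSet]
  filter_upwards [h0] with x hx hxΩ
  exact sub_eq_zero.1 (hx hxΩ)

/-- Density principle: a closed property is checked on smooth fields only. -/
theorem isClosed_property_H10 {p : H1 Ω → Prop} (hp : IsClosed {u | p u})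
    (h : ∀ u ∈ smoothCompact Ω, p u) {u : H1 Ω} (hu : u ∈ H10 Ω) : p u :=
  closure_minimal (s := (smoothCompact Ω : Set (H1 Ω))) h hp hu

/-- `∫ ∂_j u_i ∂_i u_j = ∫ ∂_i u_i ∂_j u_j` in `H¹₀`, the identity behind Korn's inequality. -/
theorem inner_gradComp_swap (hΩ : IsOpen Ω) {u : H1 Ω} (hu : u ∈ H10 Ω) (i j : Fin 3) :
    inner ℝ (gradComp Ω i j u) (gradComp Ω j i u)
      = inner ℝ (gradComp Ω i i u) (gradComp Ω j j u) := by
  refine isClosed_property_H10 (p := fun u => inner ℝ (gradComp Ω i j u) (gradComp Ω j i u)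
      = inner ℝ (gradComp Ω i i u) (gradComp Ω j j u))
    (isClosed_eq (by fun_prop) (by fun_prop)) (fun u hu => ?_) hu
  obtain ⟨φ, hφ, -, hg⟩ := exists_test_of_mem_smoothCompact hΩ hu
  have h : ∀ i j k l, inner ℝ (gradComp Ω i j u) (gradComp Ω k l u)
      = ∫ x, pderiv j (φ i) x * pderiv l (φ k) x := by
    intro i j k l
    have h0 : ∀ x, x ∉ Ω → pderiv j (φ i) x * pderiv l (φ k) x = 0 := fun x hx => by
      rw [((hφ i).pderiv j).eq_zero_of_notMem hx, zero_mul]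
    rw [inner_L2_eq_integral, ← setIntegral_eq_integral_of_forall_compl_eq_zero h0]
    refine integral_congr_ae ?_
    filter_upwards [hg i j, hg k l] with x h1 h2
    rw [h1, h2]
  rw [h, h]
  exact integral_pderiv_mul_pderiv_swap (hφ i) (hφ j) i j

/-- Cauchy-Schwarz. It passes from the operator norm of `fderiv` in the cube inequality to the
partial derivatives in `gradSq`. -/
theorem norm_sq_eq_sum_sq_single (l : E3 →L[ℝ] ℝ) :
    ‖l‖ ^ 2 ≤ ∑ j, (l (EuclideanSpace.single j 1)) ^ 2 := by
  have h : ‖l‖ ≤ Real.sqrt (∑ j, (l (EuclideanSpace.single j 1)) ^ 2) := by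
    refine l.opNorm_le_bound (Real.sqrt_nonneg _) fun v => ?_
    have hv : v = ∑ j, v j • EuclideanSpace.single j (1 : ℝ) := by
      ext k
      simp [Pi.single_apply]
    have h1 : l v = ∑ j, l (EuclideanSpace.single j 1) * v j := by
      conv_lhs => rw [hv, map_sum]
      exact Finset.sum_congr rfl fun j _ => by rw [map_smul, smul_eq_mul, mul_comm]
    rw [h1, EuclideanSpace.norm_eq, ← Real.sqrt_mul (Finset.sum_nonneg fun _ _ => sq_nonneg _)]
    refine Real.abs_le_sqrt ?_
    simp only [Real.norm_eq_abs, sq_abs]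
    exact Finset.sum_mul_sq_le_sq_mul_sq _ _ _
  calc ‖l‖ ^ 2 ≤ (Real.sqrt (∑ j, (l (EuclideanSpace.single j 1)) ^ 2)) ^ 2 := by gcongr
    _ = _ := Real.sq_sqrt (Finset.sum_nonneg fun _ _ => sq_nonneg _)

/-- The compactness of `H¹₀ → L²`: up to `ε ‖u‖²_{H¹}`, the `L²` norm is controlled by
finitely many functionals. -/
theorem exists_finite_functionals (hΩ : IsOpen Ω) (hb : Bornology.IsBounded Ω) {ε : ℝ}
    (hε : 0 < ε) :
    ∃ (ι : Type) (_ : Fintype ι) (F : ι → (H1 Ω →L[ℝ] ℝ)),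
      ∀ u ∈ H10 Ω, fldSq u ≤ ∑ k, (F k u) ^ 2 + ε * ‖u‖ ^ 2 := by
  -- The side for which the factor `12 h²` of the Dirichlet integral equals `ε`.
  set h : ℝ := Real.sqrt (ε / 12) with hh
  have hh0 : 0 < h := Real.sqrt_pos.2 (by positivity)
  have hh2 : 12 * h ^ 2 = ε := by rw [hh, Real.sq_sqrt (by positivity)]; ring
  obtain ⟨s, hs⟩ := exists_finset_cube_cover hb h
  have hfin : ∀ k, (volume.restrict Ω) (cube h k) ≠ ⊤ := fun k =>
    ((Measure.restrict_apply_le _ _).trans_lt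
      (by rw [volume_cube hh0]; exact ENNReal.ofReal_lt_top)).ne
  -- One functional per cube and component: the integral over the cube, scaled so that its square is
  -- the corresponding term of the cube inequality.
  set F : s × Fin 3 → (H1 Ω →L[ℝ] ℝ) := fun p => Real.sqrt ((h ^ 3)⁻¹) •
    ((innerSL ℝ (indicatorConstLp 2 (measurableSet_cube h p.1) (hfin p.1) (1 : ℝ))).comp
      (fldComp Ω p.2)) with hF
  have hFa : ∀ p u, (F p u) ^ 2
      = (h ^ 3)⁻¹ * ‖∫ x in cube h p.1, fldComp Ω p.2 u x ∂(volume.restrict Ω)‖ ^ 2 := by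
    intro p u
    have : F p u = Real.sqrt ((h ^ 3)⁻¹) *
        ∫ x in cube h p.1, fldComp Ω p.2 u x ∂(volume.restrict Ω) := by
      rw [← L2.inner_indicatorConstLp_one (𝕜 := ℝ) (measurableSet_cube h p.1) (hfin p.1)]
      rfl
    rw [this, mul_pow, Real.sq_sqrt (by positivity), Real.norm_eq_abs, sq_abs]
  refine ⟨s × Fin 3, inferInstance, F, fun u hu => ?_⟩
  refine isClosed_property_H10 (p := fun u => fldSq u ≤ ∑ k, (F k u) ^ 2 + ε * ‖u‖ ^ 2)
    (isClosed_le (by unfold fldSq; fun_prop) (by fun_prop)) (fun u hu => ?_) hu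
  obtain ⟨φ, hφ, hf, hg⟩ := exists_test_of_mem_smoothCompact hΩ hu
  have hset : ∀ G : E3 → ℝ, (∀ x, x ∉ Ω → G x = 0) → ∫ x in Ω, G x = ∫ x, G x := fun G hG =>
    setIntegral_eq_integral_of_forall_compl_eq_zero fun x hx => hG x hx
  have hnorm : ∀ (f : L2 Ω ℝ) (ψ : E3 → ℝ), IsTestFunction Ω ψ → f =ᵐ[volume.restrict Ω] ψ →
      ‖f‖ ^ 2 = ∫ x, ψ x ^ 2 := by
    intro f ψ hψ hfψ
    rw [← real_inner_self_eq_norm_sq, inner_L2_eq_integral,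
      ← hset _ fun x hx => by simp [hψ.eq_zero_of_notMem hx]]
    refine integral_congr_ae ?_
    filter_upwards [hfψ] with x hx
    rw [hx, sq]
  have hi : ∀ i, ‖fldComp Ω i u‖ ^ 2 ≤ ∑ k : s, (F (k, i) u) ^ 2
      + ε * ∑ j, ‖gradComp Ω i j u‖ ^ 2 := by
    intro i
    have h1 := integral_norm_sq_le_sum_cube ((hφ i).contDiff.of_le (by simp))
      (hφ i).hasCompactSupport hh0 (s := s)
      ((subset_tsupport _).trans ((hφ i).tsupport_subset.trans hs))
    simp only [Real.norm_eq_abs, sq_abs] at h1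
    rw [← hnorm _ _ (hφ i) (hf i), hh2] at h1
    refine h1.trans (add_le_add (le_of_eq ?_) (mul_le_mul_of_nonneg_left ?_ hε.le))
    · rw [← Finset.sum_coe_sort s]
      refine Finset.sum_congr rfl fun k _ => ?_
      rw [hFa, Real.norm_eq_abs, sq_abs]
      congr 2
      simp only
      rw [← integral_indicator (measurableSet_cube h k), ← hset _ fun x hx => by
        by_cases hxk : x ∈ cube h k <;> simp [hxk, (hφ i).eq_zero_of_notMem hx],
        integral_indicator (measurableSet_cube h k)]
      refine setIntegral_congr_ae (measurableSet_cube h k) ?_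
      filter_upwards [hf i] with x hx _
      exact hx.symm
    · rw [Finset.sum_congr rfl fun j _ => hnorm _ _ ((hφ i).pderiv j) (hg i j),
        ← integral_finsetSum _ fun j _ => by
          simpa only [sq] using ((hφ i).pderiv j).integrable_mul ((hφ i).pderiv j)]
      refine integral_mono_of_nonneg (Filter.Eventually.of_forall fun x => by positivity) ?_
        (Filter.Eventually.of_forall fun x => norm_sq_eq_sum_sq_single _)
      exact integrable_finsetSum _ fun j _ => by
        simpa only [sq] using ((hφ i).pderiv j).integrable_mul ((hφ i).pderiv j)
  have h2 := Finset.sum_le_sum fun i (_ : i ∈ Finset.univ) => hi i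
  rw [Finset.sum_add_distrib, ← Finset.mul_sum] at h2
  have h3 : ∑ k, (F k u) ^ 2 = ∑ i, ∑ k : s, (F (k, i) u) ^ 2 := by
    rw [Fintype.sum_prod_type_right]
  rw [h3]
  refine h2.trans ?_
  gcongr
  rw [norm_sq_eq_fldSq_add_gradSq]
  exact le_add_of_nonneg_left (fldSq_nonneg u)

end Sobolev

/-! ### Elastic and mass forms: boundedness and pointwise comparison -/

section Forms

variable {Ω : Set E3}

theorem integrable_weight_mul {c : E3 → ℝ} {K : ℝ} (hc : AEMeasurable c (volume.restrict Ω))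
    (hK : ∀ᵐ x ∂(volume.restrict Ω), |c x| ≤ K) (f g : L2 Ω ℝ) :
    Integrable (fun x => c x * (f x * g x)) (volume.restrict Ω) :=
  ((Lp.memLp f).integrable_mul (Lp.memLp g)).bdd_mul hc.aestronglyMeasurable hK

/-- `(f, g) ↦ ∫ c f g` for a bounded weight `c`. -/
theorem exists_weightedForm {c : E3 → ℝ} {K : ℝ} (hc : AEMeasurable c (volume.restrict Ω))
    (hK : ∀ᵐ x ∂(volume.restrict Ω), |c x| ≤ K) :
    ∃ b : L2 Ω ℝ →L[ℝ] L2 Ω ℝ →L[ℝ] ℝ, (∀ f g, b f g = ∫ x in Ω, c x * (f x * g x)) ∧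
      ∀ f g, |b f g| ≤ |K| * ‖f‖ * ‖g‖ := by
  have hint := integrable_weight_mul (Ω := Ω) hc hK
  -- The bound uses `|K|` because `K` may be negative when Ω is a null set.
  have hbound : ∀ f g : L2 Ω ℝ, ‖∫ x in Ω, c x * (f x * g x)‖ ≤ |K| * ‖f‖ * ‖g‖ := by
    intro f g
    have hmem : MemLp (fun x => c x * f x) 2 (volume.restrict Ω) :=
      MemLp.of_le_mul (c := |K|) (Lp.memLp f)
        (hc.aestronglyMeasurable.mul (Lp.memLp f).1) (by
          filter_upwards [hK] with x hx
          rw [norm_mul]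
          exact mul_le_mul_of_nonneg_right (hx.trans (le_abs_self K)) (norm_nonneg _))
    have e : ∫ x in Ω, c x * (f x * g x) = inner ℝ (hmem.toLp _) g := by
      rw [inner_L2_eq_integral]
      refine integral_congr_ae ?_
      filter_upwards [hmem.coeFn_toLp] with x hx
      rw [hx, mul_assoc]
    have hn : ‖hmem.toLp _‖ ≤ |K| * ‖f‖ := by
      refine Lp.norm_le_mul_norm_of_ae_le_mul ?_
      filter_upwards [hK, hmem.coeFn_toLp] with x hx hx'
      rw [hx', norm_mul]
      exact mul_le_mul_of_nonneg_right (hx.trans (le_abs_self K)) (norm_nonneg _)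
    rw [e]
    exact (norm_inner_le_norm _ _).trans (mul_le_mul_of_nonneg_right hn (norm_nonneg g))
  refine ⟨LinearMap.mkContinuous₂ (LinearMap.mk₂ ℝ
    (fun f g : L2 Ω ℝ => ∫ x in Ω, c x * (f x * g x)) ?_ ?_ ?_ ?_) |K| hbound,
    fun f g => rfl, hbound⟩
  · intro f f' g
    rw [← integral_add (hint f g) (hint f' g)]
    refine integral_congr_ae ?_
    filter_upwards [Lp.coeFn_add f f'] with x hx
    rw [hx, Pi.add_apply]
    ring
  · intro r f g
    rw [smul_eq_mul, ← integral_const_mul]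
    refine integral_congr_ae ?_
    filter_upwards [Lp.coeFn_smul r f] with x hx
    rw [hx, Pi.smul_apply, smul_eq_mul]
    ring
  · intro f g g'
    rw [← integral_add (hint f g) (hint f g')]
    refine integral_congr_ae ?_
    filter_upwards [Lp.coeFn_add g g'] with x hx
    rw [hx, Pi.add_apply]
    ring
  · intro r f g
    rw [smul_eq_mul, ← integral_const_mul]
    refine integral_congr_ae ?_
    filter_upwards [Lp.coeFn_smul r g] with x hx
    rw [hx, Pi.smul_apply, smul_eq_mul]
    ring

/-- Expanding the symmetrisation turns the elastic form into a finite sum of weighted L² products of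
gradient entries, from which boundedness and the constant-coefficient formula follow. -/
theorem ddot_isoTensor_symPart (l m : ℝ) (A B : Matrix (Fin 3) (Fin 3) ℝ) :
    ddot (isoTensor l m (symPart A)) (symPart B)
      = ∑ i, ∑ j, (l * (A i i * B j j) + m * (A i j * B i j) + m * (A i j * B j i)) := by
  simp [ddot, isoTensor, symPart, Fin.sum_univ_three, Matrix.one_apply]
  ring

theorem gradComp_ae_eq (u : H1 Ω) :
    ∀ᵐ x ∂(volume.restrict Ω), ∀ i j, gradComp Ω i j u x = grad u x i j :=
  MeasureTheory.ae_all_iff.2 fun i => MeasureTheory.ae_all_iff.2 fun j => coeFn_gradComp i j u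

theorem fldComp_ae_eq (u : H1 Ω) :
    ∀ᵐ x ∂(volume.restrict Ω), ∀ i, fldComp Ω i u x = fld u x i :=
  MeasureTheory.ae_all_iff.2 fun i => coeFn_fldComp i u

theorem integrable_elastic {lam mu : E3 → ℝ} {K : ℝ}
    (hl : AEMeasurable lam (volume.restrict Ω)) (hm : AEMeasurable mu (volume.restrict Ω))
    (hlK : ∀ᵐ x ∂(volume.restrict Ω), |lam x| ≤ K)
    (hmK : ∀ᵐ x ∂(volume.restrict Ω), |mu x| ≤ K) (u v : H1 Ω) :
    Integrable (fun x => ddot (isoTensor (lam x) (mu x) (strain u x)) (strain v x))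
      (volume.restrict Ω) := by
  have h : Integrable (fun x => ∑ i, ∑ j,
      (lam x * (gradComp Ω i i u x * gradComp Ω j j v x)
        + mu x * (gradComp Ω i j u x * gradComp Ω i j v x)
        + mu x * (gradComp Ω i j u x * gradComp Ω j i v x))) (volume.restrict Ω) :=
    integrable_finsetSum _ fun i _ => integrable_finsetSum _ fun j _ =>
      ((integrable_weight_mul hl hlK _ _).add (integrable_weight_mul hm hmK _ _)).add
        (integrable_weight_mul hm hmK _ _)
  refine h.congr ?_
  filter_upwards [gradComp_ae_eq u, gradComp_ae_eq v] with x h1 h2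
  rw [strain, strain, ddot_isoTensor_symPart]
  simp only [h1, h2]

theorem elasticForm_eq_sum {lam mu : E3 → ℝ} {K : ℝ}
    (hl : AEMeasurable lam (volume.restrict Ω)) (hm : AEMeasurable mu (volume.restrict Ω))
    (hlK : ∀ᵐ x ∂(volume.restrict Ω), |lam x| ≤ K)
    (hmK : ∀ᵐ x ∂(volume.restrict Ω), |mu x| ≤ K) (u v : H1 Ω) :
    elasticForm lam mu u v = ∑ i, ∑ j,
      ((∫ x in Ω, lam x * (gradComp Ω i i u x * gradComp Ω j j v x))
        + (∫ x in Ω, mu x * (gradComp Ω i j u x * gradComp Ω i j v x))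
        + (∫ x in Ω, mu x * (gradComp Ω i j u x * gradComp Ω j i v x))) := by
  have hL := integrable_weight_mul (Ω := Ω) hl hlK
  have hM := integrable_weight_mul (Ω := Ω) hm hmK
  have hi : ∀ i j, Integrable (fun x => lam x * (gradComp Ω i i u x * gradComp Ω j j v x)
        + mu x * (gradComp Ω i j u x * gradComp Ω i j v x)
        + mu x * (gradComp Ω i j u x * gradComp Ω j i v x)) (volume.restrict Ω) := fun i j =>
    ((hL _ _).add (hM _ _)).add (hM _ _)
  have e : ∀ i j, (∫ x in Ω, lam x * (gradComp Ω i i u x * gradComp Ω j j v x))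
        + (∫ x in Ω, mu x * (gradComp Ω i j u x * gradComp Ω i j v x))
        + (∫ x in Ω, mu x * (gradComp Ω i j u x * gradComp Ω j i v x))
      = ∫ x in Ω, (lam x * (gradComp Ω i i u x * gradComp Ω j j v x)
        + mu x * (gradComp Ω i j u x * gradComp Ω i j v x)
        + mu x * (gradComp Ω i j u x * gradComp Ω j i v x)) := fun i j => by
    rw [← integral_add (hL _ _) (hM _ _)]
    exact (integral_add ((hL _ _).add (hM _ _)) (hM _ _)).symm
  simp only [e]
  simp only [← integral_finsetSum _ fun j _ => hi _ j]
  rw [← integral_finsetSum _ fun i _ => integrable_finsetSum _ fun j _ => hi i j]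
  refine integral_congr_ae ?_
  filter_upwards [gradComp_ae_eq u, gradComp_ae_eq v] with x h1 h2
  simp only [strain, ddot_isoTensor_symPart, h1, h2]

/-- The elastic form as a bounded bilinear form. -/
theorem exists_elasticForm {lam mu : E3 → ℝ} {K : ℝ}
    (hl : AEMeasurable lam (volume.restrict Ω)) (hm : AEMeasurable mu (volume.restrict Ω))
    (hlK : ∀ᵐ x ∂(volume.restrict Ω), |lam x| ≤ K)
    (hmK : ∀ᵐ x ∂(volume.restrict Ω), |mu x| ≤ K) :
    ∃ b : H1 Ω →L[ℝ] H1 Ω →L[ℝ] ℝ, (∀ u v, b u v = elasticForm lam mu u v) ∧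
      ∀ u v, |b u v| ≤ 27 * |K| * ‖u‖ * ‖v‖ := by
  obtain ⟨bl, hbl, hbl'⟩ := exists_weightedForm (Ω := Ω) hl hlK
  obtain ⟨bm, hbm, hbm'⟩ := exists_weightedForm (Ω := Ω) hm hmK
  refine ⟨∑ i, ∑ j, (bl.bilinearComp (gradComp Ω i i) (gradComp Ω j j)
    + bm.bilinearComp (gradComp Ω i j) (gradComp Ω i j)
    + bm.bilinearComp (gradComp Ω i j) (gradComp Ω j i)), fun u v => ?_, fun u v => ?_⟩
  · rw [elasticForm_eq_sum hl hm hlK hmK]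
    simp [hbl, hbm]
  · have h1 : ∀ i j k l, |bl (gradComp Ω i j u) (gradComp Ω k l v)| ≤ |K| * ‖u‖ * ‖v‖ :=
      fun i j k l => (hbl' _ _).trans (by
        gcongr
        · exact norm_gradComp_le i j u
        · exact norm_gradComp_le k l v)
    have h2 : ∀ i j k l, |bm (gradComp Ω i j u) (gradComp Ω k l v)| ≤ |K| * ‖u‖ * ‖v‖ :=
      fun i j k l => (hbm' _ _).trans (by
        gcongr
        · exact norm_gradComp_le i j u
        · exact norm_gradComp_le k l v)
    simp only [FunLike.coe_sum, Finset.sum_apply, add_apply,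
      ContinuousLinearMap.bilinearComp_apply]
    -- The factor 27 counts nine index pairs with three terms each.
    calc _ ≤ ∑ i : Fin 3, ∑ j : Fin 3, 3 * (|K| * ‖u‖ * ‖v‖) := by
          refine (Finset.abs_sum_le_sum_abs _ _).trans (Finset.sum_le_sum fun i _ => ?_)
          refine (Finset.abs_sum_le_sum_abs _ _).trans (Finset.sum_le_sum fun j _ => ?_)
          refine (abs_add_three _ _ _).trans ?_
          linarith [h1 i i j j, h2 i j i j, h2 i j j i]
      _ = _ := by simp; ring

/-- The mass form as a bounded bilinear form. -/
theorem exists_massForm {ρ : E3 → ℝ} {K : ℝ} (hρ : AEMeasurable ρ (volume.restrict Ω))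
    (hK : ∀ᵐ x ∂(volume.restrict Ω), |ρ x| ≤ K) :
    ∃ b : H1 Ω →L[ℝ] H1 Ω →L[ℝ] ℝ, (∀ u v, b u v = massForm ρ u v) ∧
      ∀ u v, |b u v| ≤ 3 * |K| * ‖u‖ * ‖v‖ := by
  obtain ⟨b, hb, hb'⟩ := exists_weightedForm (Ω := Ω) hρ hK
  refine ⟨∑ i, b.bilinearComp (fldComp Ω i) (fldComp Ω i), fun u v => ?_, fun u v => ?_⟩
  · simp only [FunLike.coe_sum, Finset.sum_apply, ContinuousLinearMap.bilinearComp_apply, hb]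
    rw [← integral_finsetSum _ fun i _ => integrable_weight_mul hρ hK _ _]
    refine integral_congr_ae ?_
    filter_upwards [fldComp_ae_eq u, fldComp_ae_eq v] with x h1 h2
    simp only [h1, h2, ← Finset.mul_sum, PiLp.inner_apply, RCLike.inner_apply, conj_trivial,
      mul_comm (fld u x _)]
  · simp only [FunLike.coe_sum, Finset.sum_apply, ContinuousLinearMap.bilinearComp_apply]
    calc _ ≤ ∑ i : Fin 3, |K| * ‖u‖ * ‖v‖ := by
          refine (Finset.abs_sum_le_sum_abs _ _).trans (Finset.sum_le_sum fun i _ => ?_)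
          refine (hb' _ _).trans ?_
          gcongr
          · exact norm_fldComp_le i u
          · exact norm_fldComp_le i v
      _ = _ := by simp; ring

theorem massForm_one_self (u : H1 Ω) : massForm (fun _ => 1) u u = fldSq u := by
  simp only [fldSq, ← real_inner_self_eq_norm_sq, inner_L2_eq_integral]
  rw [← integral_finsetSum _ fun i _ => (Lp.memLp _).integrable_mul (Lp.memLp _)]
  refine integral_congr_ae ?_
  filter_upwards [fldComp_ae_eq u] with x h1
  simp only [h1, one_mul, real_inner_self_eq_norm_sq, EuclideanSpace.real_norm_sq_eq]
  exact Finset.sum_congr rfl fun i _ => sq _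

theorem integrable_mass {ρ : E3 → ℝ} {K : ℝ} (hρ : AEMeasurable ρ (volume.restrict Ω))
    (hK : ∀ᵐ x ∂(volume.restrict Ω), |ρ x| ≤ K) (u v : H1 Ω) :
    Integrable (fun x => ρ x * inner ℝ (fld u x) (fld v x)) (volume.restrict Ω) :=
  (L2.integrable_inner u.1.fst v.1.fst).bdd_mul hρ.aestronglyMeasurable hK

theorem massForm_self_le {ρ : E3 → ℝ} {K : ℝ} (hρ : AEMeasurable ρ (volume.restrict Ω))
    (hK : ∀ᵐ x ∂(volume.restrict Ω), |ρ x| ≤ K) (u : H1 Ω) : massForm ρ u u ≤ K * fldSq u := by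
  rw [← massForm_one_self, massForm, massForm, ← integral_const_mul]
  refine integral_mono_ae (integrable_mass hρ hK u u)
    ((integrable_mass (K := 1) aemeasurable_const (by simp) u u).const_mul K) ?_
  filter_upwards [hK] with x hx
  simp only [one_mul]
  exact mul_le_mul_of_nonneg_right ((le_abs_self _).trans hx) real_inner_self_nonneg

/-- `∫ (div u)²`. -/
def divSq (u : H1 Ω) : ℝ := ‖∑ i, gradComp Ω i i u‖ ^ 2

theorem divSq_eq_sum (u : H1 Ω) :
    divSq u = ∑ i, ∑ j, inner ℝ (gradComp Ω i i u) (gradComp Ω j j u) := by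
  rw [divSq, ← real_inner_self_eq_norm_sq, sum_inner]
  simp only [inner_sum]

/-- The swap identity turns ∫ (div u)² into ∫ ∇u : (∇u)ᵀ, which is at most ‖∇u‖² by Cauchy-Schwarz
and Young's inequality. -/
theorem divSq_le_gradSq (hΩ : IsOpen Ω) {u : H1 Ω} (hu : u ∈ H10 Ω) : divSq u ≤ gradSq u := by
  have e : divSq u = ∑ i, ∑ j, inner ℝ (gradComp Ω i j u) (gradComp Ω j i u) := by
    rw [divSq_eq_sum]
    exact Finset.sum_congr rfl fun i _ => Finset.sum_congr rfl fun j _ =>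
      (inner_gradComp_swap hΩ hu i j).symm
  rw [e]
  have h : ∀ i j, inner ℝ (gradComp Ω i j u) (gradComp Ω j i u)
      ≤ (‖gradComp Ω i j u‖ ^ 2 + ‖gradComp Ω j i u‖ ^ 2) / 2 := fun i j => by
    have h1 := real_inner_le_norm (gradComp Ω i j u) (gradComp Ω j i u)
    nlinarith [sq_nonneg (‖gradComp Ω i j u‖ - ‖gradComp Ω j i u‖)]
  calc _ ≤ ∑ i, ∑ j, (‖gradComp Ω i j u‖ ^ 2 + ‖gradComp Ω j i u‖ ^ 2) / 2 :=
        Finset.sum_le_sum fun i _ => Finset.sum_le_sum fun j _ => h i j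
    _ = (gradSq u + ∑ i, ∑ j, ‖gradComp Ω j i u‖ ^ 2) / 2 := by
        simp only [gradSq, ← Finset.sum_div, Finset.sum_add_distrib]
    _ = gradSq u := by
        rw [Finset.sum_comm]
        exact add_self_div_two _

/-- For constant Lamé parameters, `∫ ℂ ∇̂u : ∇̂u = m ‖∇u‖² + (l + m) ‖div u‖²` in `H¹₀`. -/
theorem elasticForm_const_self (hΩ : IsOpen Ω) {u : H1 Ω} (hu : u ∈ H10 Ω) (l m : ℝ) :
    elasticForm (fun _ => l) (fun _ => m) u u = m * gradSq u + (l + m) * divSq u := by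
  have e : elasticForm (fun _ => l) (fun _ => m) u u = ∑ i, ∑ j,
      (l * inner ℝ (gradComp Ω i i u) (gradComp Ω j j u) + m * ‖gradComp Ω i j u‖ ^ 2
        + m * inner ℝ (gradComp Ω i i u) (gradComp Ω j j u)) := by
    rw [elasticForm_eq_sum (K := max |l| |m|) aemeasurable_const aemeasurable_const
      (Filter.Eventually.of_forall fun _ => le_max_left _ _)
      (Filter.Eventually.of_forall fun _ => le_max_right _ _)]
    refine Finset.sum_congr rfl fun i _ => Finset.sum_congr rfl fun j _ => ?_
    rw [integral_const_mul, integral_const_mul, integral_const_mul, ← inner_L2_eq_integral,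
      ← inner_L2_eq_integral, ← inner_L2_eq_integral, inner_gradComp_swap hΩ hu,
      real_inner_self_eq_norm_sq]
  rw [e]
  simp only [Finset.sum_add_distrib, ← Finset.mul_sum]
  rw [← divSq_eq_sum, ← gradSq]
  ring

/-- The quadratic form of an isotropic tensor splits into a spherical part with modulus `(2m + 3l) /
3` and a deviatoric part with modulus `2m`, so it is monotone in both; the difference is an explicit
sum of squares. -/
theorem ddot_isoTensor_symPart_mono {l m l' m' : ℝ} (hm : m' ≤ m)
    (hl : 2 * m' + 3 * l' ≤ 2 * m + 3 * l) (A : Matrix (Fin 3) (Fin 3) ℝ) :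
    ddot (isoTensor l' m' (symPart A)) (symPart A)
      ≤ ddot (isoTensor l m (symPart A)) (symPart A) := by
  have h : ddot (isoTensor l m (symPart A)) (symPart A)
      - ddot (isoTensor l' m' (symPart A)) (symPart A)
      = (2 * m + 3 * l - (2 * m' + 3 * l')) / 3 * (A 0 0 + A 1 1 + A 2 2) ^ 2
        + (m - m') * ((A 0 1 + A 1 0) ^ 2 + (A 0 2 + A 2 0) ^ 2 + (A 1 2 + A 2 1) ^ 2
        + 2 / 3 * ((A 0 0 - A 1 1) ^ 2 + (A 0 0 - A 2 2) ^ 2 + (A 1 1 - A 2 2) ^ 2)) := by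
    simp only [ddot_isoTensor_symPart, Fin.sum_univ_three]
    ring
  have h1 : 0 ≤ m - m' := sub_nonneg.2 hm
  have h2 : 0 ≤ 2 * m + 3 * l - (2 * m' + 3 * l') := sub_nonneg.2 hl
  have h3 : 0 ≤ ddot (isoTensor l m (symPart A)) (symPart A)
      - ddot (isoTensor l' m' (symPart A)) (symPart A) := by
    rw [h]
    positivity
  linarith

theorem symm_elasticForm_const (l m : ℝ) (u v : H1 Ω) :
    elasticForm (fun _ => l) (fun _ => m) u v = elasticForm (fun _ => l) (fun _ => m) v u := by
  refine integral_congr_ae (Filter.Eventually.of_forall fun x => ?_)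
  simp only [strain, ddot_isoTensor_symPart, Fin.sum_univ_three]
  ring

theorem symm_massForm (ρ : E3 → ℝ) (u v : H1 Ω) : massForm ρ u v = massForm ρ v u := by
  refine integral_congr_ae (Filter.Eventually.of_forall fun x => ?_)
  simp only [real_inner_comm]

end Forms

/-! ### Rayleigh bound for the smallest eigenvalue, and coercivity -/

section Main

variable {Ω : Set E3}

set_option maxHeartbeats 1000000 in
/-- The smallest Dirichlet eigenvalue bounds the Rayleigh quotient from below. -/
theorem smallestEigenvalue_mul_fldSq_le (hΩ : IsOpen Ω) (hb : Bornology.IsBounded Ω)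
    {α₀ β₀ κ : ℝ} (hα₀ : 0 < α₀) (hβ₀ : 0 < β₀)
    (hκ : IsSmallestDirichletEigenvalue Ω α₀ β₀ κ) {u : H1 Ω} (hu : u ∈ H10 Ω) :
    κ * fldSq u
      ≤ elasticForm (fun _ => (β₀ - 3 * α₀) / 2) (fun _ => α₀) u u := by
  set l : ℝ := (β₀ - 3 * α₀) / 2 with hl
  obtain ⟨A, hA, -⟩ := exists_elasticForm (Ω := Ω) (lam := fun _ => l) (mu := fun _ => α₀)
    (K := max |l| |α₀|) aemeasurable_const aemeasurable_const
    (Filter.Eventually.of_forall fun _ => le_max_left _ _)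
    (Filter.Eventually.of_forall fun _ => le_max_right _ _)
  obtain ⟨N, hN, -⟩ := exists_massForm (Ω := Ω) (ρ := fun _ => 1) (K := 1) aemeasurable_const
    (by simp)
  -- In H¹₀ the ℂ₀-energy is `α₀ (‖∇u‖² - ‖div u‖²) + (α₀ + β₀) / 2 ‖div u‖²` with both terms
  -- nonnegative, although ℂ₀ may be indefinite pointwise; `c` is the least of these weights and of
  -- the weight 1 of the L² term.
  set c : ℝ := min 1 (min α₀ ((α₀ + β₀) / 2)) with hc
  have hc0 : 0 < c := lt_min one_pos (lt_min hα₀ (by linarith))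
  have key := rayleigh_lower_bound_of_mem (K := H10 Ω) (A := A) (N := N) (c := c) (κ := κ)
    (fun u v => by
      rw [hA, hA]
      exact symm_elasticForm_const _ _ _ _)
    (fun u v => by
      rw [hN, hN]
      exact symm_massForm _ _ _)
    (fun u => by
      rw [hN, massForm_one_self]
      exact fldSq_nonneg _) hc0
    (fun u hu => by
      rw [hN, hA, massForm_one_self, elasticForm_const_self hΩ hu, norm_sq_eq_fldSq_add_gradSq]
      have h1 : c ≤ 1 := min_le_left _ _
      have h2 : c ≤ α₀ := (min_le_right _ _).trans (min_le_left _ _)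
      have h3 : c ≤ (α₀ + β₀) / 2 := (min_le_right _ _).trans (min_le_right _ _)
      have h5 : 0 ≤ divSq u := sq_nonneg _
      have h6 := mul_le_mul_of_nonneg_right h1 (fldSq_nonneg u)
      have h7 := mul_le_mul_of_nonneg_right h2 (sub_nonneg.2 (divSq_le_gradSq hΩ hu))
      have h8 := mul_le_mul_of_nonneg_right h3 h5
      rw [hl]
      linarith)
    (fun ε hε => by
      obtain ⟨ι, hι, F, hF⟩ := exists_finite_functionals hΩ hb hε
      refine ⟨ι, hι, F, fun u hu => ?_⟩
      rw [hN, massForm_one_self]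
      exact hF u hu)
    (fun k ⟨u, hu, hu0, h⟩ => hκ.2 ⟨u, hu, hu0, fun v hv => by
      rw [← hA, ← hN]
      exact h v hv⟩)
    hu
  rwa [hN, hA, massForm_one_self] at key

/-- Half of the ℂ₀-energy pays for the mass term; the remaining `α₀ / 2 ‖∇u‖²` controls the full
norm because the Rayleigh bound also yields a Poincaré inequality with constant `(α₀ + β₀) / κ`. -/
theorem elastic_sub_mass_coercive (hΩ : IsOpen Ω) (hb : Bornology.IsBounded Ω)
    {α₀ β₀ γ₀ κ : ℝ} (hα₀ : 0 < α₀) (hβ₀ : 0 < β₀) (hγ₀ : 0 < γ₀) (hκ0 : 0 < κ)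
    (hκ : IsSmallestDirichletEigenvalue Ω α₀ β₀ κ) {lam mu ρ : E3 → ℝ} {K : ℝ}
    (hadm : AdmissibleCoefficients Ω α₀ β₀ γ₀ lam mu ρ)
    (hlK : ∀ᵐ x ∂(volume.restrict Ω), |lam x| ≤ K)
    (hmK : ∀ᵐ x ∂(volume.restrict Ω), |mu x| ≤ K)
    {ω : ℝ} (hω : ω ^ 2 ≤ γ₀ * κ / 2) {u : H1 Ω} (hu : u ∈ H10 Ω) :
    α₀ / 2 / (1 + (α₀ + β₀) / κ) * ‖u‖ ^ 2
      ≤ elasticForm lam mu u u - ω ^ 2 * massForm ρ u u := by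
  -- These parameters are those of ½ℂ₀ + α₀𝕀_sym. They are admissible for comparison since `2α₀ +
  -- 3(β₀ - 3α₀)/4 = (3β₀ - α₀)/4 ≤ β₀`.
  have h1 : elasticForm (fun _ => (β₀ - 3 * α₀) / 4) (fun _ => α₀) u u ≤ elasticForm lam mu u u := by
    refine integral_mono_ae
      (integrable_elastic (K := max |(β₀ - 3 * α₀) / 4| |α₀|) aemeasurable_const aemeasurable_const
        (Filter.Eventually.of_forall fun _ => le_max_left _ _)
        (Filter.Eventually.of_forall fun _ => le_max_right _ _) u u)
      (integrable_elastic hadm.aemeasurable_lam hadm.aemeasurable_mu hlK hmK u u) ?_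
    filter_upwards [hadm.mu_bounds, hadm.lam_bounds] with x hx hx'
    refine ddot_isoTensor_symPart_mono hx.1 ?_ _
    linarith [hx'.1]
  have h2 := smallestEigenvalue_mul_fldSq_le hΩ hb hα₀ hβ₀ hκ hu
  rw [elasticForm_const_self hΩ hu] at h1 h2
  have h3 : massForm ρ u u ≤ γ₀⁻¹ * fldSq u := massForm_self_le hadm.aemeasurable_rho (by
    filter_upwards [hadm.rho_bounds] with x hx
    rw [abs_of_nonneg hx.1]
    exact hx.2) u
  have h4 : ω ^ 2 * massForm ρ u u ≤ κ / 2 * fldSq u := by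
    calc ω ^ 2 * massForm ρ u u ≤ ω ^ 2 * (γ₀⁻¹ * fldSq u) := by gcongr
      _ ≤ γ₀ * κ / 2 * (γ₀⁻¹ * fldSq u) := by
        have := fldSq_nonneg u
        gcongr
      _ = κ / 2 * fldSq u := by field_simp
  have h5 := divSq_le_gradSq hΩ hu
  have h6 : 0 ≤ divSq u := sq_nonneg _
  have h7 : fldSq u ≤ (α₀ + β₀) / κ * gradSq u := by
    rw [div_mul_eq_mul_div, le_div_iff₀ hκ0]
    nlinarith [mul_nonneg hα₀.le (gradSq_nonneg u), mul_le_mul_of_nonneg_left h5 hβ₀.le,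
      mul_nonneg hα₀.le h6, mul_nonneg hβ₀.le (gradSq_nonneg u)]
  -- Subtracting half of `h2` from `h1` leaves `α₀ / 2 (‖∇u‖² + ‖div u‖²)`.
  have h8 : α₀ / 2 * gradSq u ≤ elasticForm lam mu u u - ω ^ 2 * massForm ρ u u := by
    have := mul_nonneg hα₀.le h6
    linarith
  refine le_trans ?_ h8
  rw [div_mul_eq_mul_div, div_le_iff₀ (by positivity), norm_sq_eq_fldSq_add_gradSq, mul_assoc]
  gcongr
  linarith

end Main

end Elasticity

end

/-! ### The Dirichlet problem -/

set_option maxHeartbeats 1000000 in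
theorem proposition2p1 (α₀ β₀ γ₀ lam₁ : ℝ) (hα₀ : 0 < α₀) (hβ₀ : 0 < β₀) (hγ₀ : 0 < γ₀) :
    ∃ C : ℝ, 0 < C ∧
      ∀ Ω : Set Elasticity.E3, Elasticity.IsBoundedLipschitzDomain Ω →
      Elasticity.IsSmallestDirichletEigenvalue Ω α₀ β₀ lam₁ →
      ∀ lam mu ρ : Elasticity.E3 → ℝ,
      Elasticity.AdmissibleCoefficients Ω α₀ β₀ γ₀ lam mu ρ →
      ∀ ω : ℝ, 0 < ω ^ 2 → ω ^ 2 ≤ γ₀ * lam₁ / 2 →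
      ∀ (f : Elasticity.Hneg1 Ω) (g : Elasticity.Hhalf Ω),
        (∃! u : Elasticity.H1 Ω, Elasticity.IsWeakSolution lam mu ρ ω f g u) ∧
        ∀ u : Elasticity.H1 Ω, Elasticity.IsWeakSolution lam mu ρ ω f g u →
          ‖u‖ ≤ C * (‖g‖ + ‖f‖) := by
  -- For `lam₁ ≤ 0` no frequency is allowed, and any constant will do.
  rcases le_or_gt lam₁ 0 with hl | hl
  · refine ⟨1, one_pos, fun Ω _ _ lam mu ρ _ ω h1 h2 => ?_⟩
    have := mul_nonpos_of_nonneg_of_nonpos hγ₀.le hl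
    linarith
  -- A crude common bound for `|lam|` and `|mu|`.
  set K : ℝ := β₀⁻¹ + α₀⁻¹ with hK
  have hK0 : 0 < K := by positivity
  set c : ℝ := α₀ / 2 / (1 + (α₀ + β₀) / lam₁) with hc
  have hc0 : 0 < c := by positivity
  -- Continuity constant of the whole form, with `ω ^ 2` replaced by its largest allowed value so
  -- that it depends only on the given constants.
  set M : ℝ := 27 * K + γ₀ * lam₁ / 2 * (3 * γ₀⁻¹) with hM
  have hM0 : 0 < M := by positivity
  refine ⟨1 + (M + 1) / c, by positivity, fun Ω hΩ hκ lam mu ρ hadm ω hω0 hω f g => ?_⟩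
  have hmK : ∀ᵐ x ∂(volume.restrict Ω), |mu x| ≤ K := by
    filter_upwards [hadm.mu_bounds] with x hx
    rw [abs_of_pos (hα₀.trans_le hx.1)]
    have : 0 < β₀⁻¹ := by positivity
    linarith [hx.2]
  have hlK : ∀ᵐ x ∂(volume.restrict Ω), |lam x| ≤ K := by
    filter_upwards [hadm.mu_bounds, hadm.lam_bounds] with x hx hx'
    have : 0 < β₀⁻¹ := by positivity
    rw [abs_le]
    constructor <;> linarith [hx.1, hx.2, hx'.1, hx'.2]
  have hρK : ∀ᵐ x ∂(volume.restrict Ω), |ρ x| ≤ γ₀⁻¹ := by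
    filter_upwards [hadm.rho_bounds] with x hx
    rw [abs_of_nonneg hx.1]
    exact hx.2
  obtain ⟨A, hA, hA'⟩ := Elasticity.exists_elasticForm hadm.aemeasurable_lam
    hadm.aemeasurable_mu hlK hmK
  obtain ⟨N, hN, hN'⟩ := Elasticity.exists_massForm hadm.aemeasurable_rho hρK
  rw [abs_of_pos hK0] at hA'
  rw [abs_of_pos (inv_pos.2 hγ₀)] at hN'
  have key := Elasticity.existsUnique_of_coercive_of_boundary (K := Elasticity.H10 Ω)
    (A - ω ^ 2 • N) hc0 hM0.le
    (fun u v => by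
      simp only [sub_apply, smul_apply, smul_eq_mul]
      calc |A u v - ω ^ 2 * N u v| ≤ |A u v| + |ω ^ 2 * N u v| := abs_sub _ _
        _ = |A u v| + ω ^ 2 * |N u v| := by rw [abs_mul, abs_of_pos hω0]
        _ ≤ 27 * K * ‖u‖ * ‖v‖ + γ₀ * lam₁ / 2 * (3 * γ₀⁻¹ * ‖u‖ * ‖v‖) := by
          gcongr
          · exact hA' u v
          · exact hN' u v
        _ = M * ‖u‖ * ‖v‖ := by rw [hM]; ring)
    (fun u => by
      simp only [sub_apply, smul_apply, smul_eq_mul, hA, hN]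
      exact Elasticity.elastic_sub_mass_coercive hΩ.isOpen hΩ.isBounded hα₀ hβ₀ hγ₀ hl hκ hadm
        hlK hmK hω u.2)
    f g
  have hiff : ∀ u : Elasticity.H1 Ω, Elasticity.IsWeakSolution lam mu ρ ω f g u ↔
      (∀ v : Elasticity.H10 Ω, (A - ω ^ 2 • N) u v = -f v) ∧
        (Elasticity.H10 Ω).mkQ u = g := by
    intro u
    have h : ∀ v : Elasticity.H10 Ω, (A - ω ^ 2 • N) u v = -f v ↔
        -Elasticity.elasticForm lam mu u (v : Elasticity.H1 Ω)
          + ω ^ 2 * Elasticity.massForm ρ u (v : Elasticity.H1 Ω) = f v := by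
      intro v
      simp only [sub_apply, smul_apply, smul_eq_mul, hA, hN]
      constructor <;> intro h <;> linarith
    simp only [h]
    exact ⟨fun hu => ⟨hu.weak_eq, hu.boundary⟩, fun hu => ⟨hu.1, hu.2⟩⟩
  simp only [hiff]
  exact key
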